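/- Let $\mathrm{AP}$ and $\mathrm{Var}$ be sets of propositions and of variables. Formulas of the fragment pLTL$_\Diamond$ are given by $$\varphi ::= a \mid \neg a \mid \varphi\wedge\varphi \mid \varphi\vee\varphi \mid \bigcirc\varphi \mid \varphi\,\mathsf{U}\,\varphi \mid \varphi\,\mathsf{R}\,\varphi \mid \Box\varphi \mid \Diamond_{\le x}\varphi \mid \Diamond_{\le c}\varphi \mid \Box_{\le c}\varphi$$ with $a\in\mathrm{AP}$, $x\in\mathrm{Var}$, $c\in\mathbb N$. They are interpreted at positions of infinite words over $2^{\mathrm{AP}}$ under a valuation $\bar v:\mathrm{Var}\to\mathbb N$ as in linear temporal logic, where $\Diamond_{\le x}\varphi$ (resp. $\Diamond_{\le c}\varphi$) holds at position $i$ iff $\varphi$ holds at some position $j$ with $i\le j\le i+\bar v(x)$ (resp. $i\le j\le i+c$), and $\Box_{\le c}\varphi$ holds at $i$ iff $\varphi$ holds at all $j$ with $i\le j\le i+c$. The size $|\varphi|$ is the number of subformulas of $\varphi$, where a literal $\neg a$ counts as one subformula, and where $\Diamond_{\le j}\psi$ (resp. $\Box_{\le j}\psi$), $0\le j\le c$,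 count among the subformulas of $\Diamond_{\le c}\psi$ (resp. $\Box_{\le c}\psi$). Let $M$ be a finite discrete-time Markov chain with $m$ states, an initial state, and states labelled by subsets of $\mathrm{AP}$. For a pLTL$_\Diamond$ formula $\varphi$ let $V_{>0}(\varphi)$ be the set of valuations $\bar v$ for which the paths of $M$ from its initial state whose trace satisfies $\varphi$ at position $0$ under $\bar v$ have positive probability. Then $V_{>0}(\varphi)\neq\emptyset$ if and only if the uniform valuation $\bar v$ with $\bar v(x)=m\cdot|\varphi|\cdot 2^{|\varphi|}$ for every variable $x$ lies in $V_{>0}(\varphi)$. -/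

import Mathlib

open MeasureTheory ProbabilityTheory

namespace PLTL

/-- Formulas of the bounded-always-free fragment `pLTL_◇` over propositions `AP` and variables `Var`,
in negation normal form. `diaVar x φ` is `◇_{≤ x} φ`; `diaConst c φ` and `boxConst c φ` are
`◇_{≤ c} φ` and `□_{≤ c} φ` for a constant `c`. -/
inductive Formula (AP Var : Type*) where
  | pos (a : AP)
  | neg (a : AP)
  | and (φ ψ : Formula AP Var)
  | or (φ ψ : Formula AP Var)
  | next (φ : Formula AP Var)
  | until (φ ψ : Formula AP Var)
  | release (φ ψ : Formula AP Var)
  | box (φ : Formula AP Var)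
  | diaVar (x : Var) (φ : Formula AP Var)
  | diaConst (c : ℕ) (φ : Formula AP Var)
  | boxConst (c : ℕ) (φ : Formula AP Var)

namespace Formula

variable {AP Var : Type*}

/-- `Sat w v i φ` is `(w, i, v) ⊨ φ`: the infinite word `w` over `2^AP` satisfies `φ` at
position `i` under the valuation `v`. -/
def Sat (w : ℕ → Set AP) (v : Var → ℕ) : ℕ → Formula AP Var → Prop
  | i, pos a => a ∈ w i
  | i, neg a => a ∉ w i
  | i, and φ ψ => Sat w v i φ ∧ Sat w v i ψ
  | i, or φ ψ => Sat w v i φ ∨ Sat w v i ψ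
  | i, next φ => Sat w v (i + 1) φ
  | i, .until φ ψ => ∃ j, i ≤ j ∧ Sat w v j ψ ∧ ∀ k, i ≤ k → k < j → Sat w v k φ
  | i, release φ ψ => ∀ j, i ≤ j → Sat w v j ψ ∨ ∃ k, i ≤ k ∧ k < j ∧ Sat w v k φ
  | i, box φ => ∀ j, i ≤ j → Sat w v j φ
  | i, diaVar x φ => ∃ j, i ≤ j ∧ j ≤ v x + i ∧ Sat w v j φ
  | i, diaConst c φ => ∃ j, i ≤ j ∧ j ≤ c + i ∧ Sat w v j φ
  | i, boxConst c φ => ∀ j, i ≤ j → j ≤ c + i → Sat w v j φ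

open Classical in
/-- The closure of `φ`: its set of subformulas. A constant-bounded operator counts together with
its unfoldings, `◇_{≤ c+1} ψ ≡ ψ ∨ ◯ ◇_{≤ c} ψ` and `□_{≤ c+1} ψ ≡ ψ ∧ ◯ □_{≤ c} ψ`. -/
noncomputable def closure : Formula AP Var → Finset (Formula AP Var)
  | pos a => {pos a}
  | neg a => {neg a}
  | and φ ψ => insert (and φ ψ) (closure φ ∪ closure ψ)
  | or φ ψ => insert (or φ ψ) (closure φ ∪ closure ψ)
  | next φ => insert (next φ) (closure φ)
  | .until φ ψ => insert (.until φ ψ) (closure φ ∪ closure ψ)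
  | release φ ψ => insert (release φ ψ) (closure φ ∪ closure ψ)
  | box φ => insert (box φ) (closure φ)
  | diaVar x φ => insert (diaVar x φ) (closure φ)
  | diaConst c φ => (Finset.range (c + 1)).image (fun j => diaConst j φ) ∪ closure φ
  | boxConst c φ => (Finset.range (c + 1)).image (fun j => boxConst j φ) ∪ closure φ

/-- The size `|φ|` of a formula: the number of elements of its closure. -/
noncomputable def size (φ : Formula AP Var) : ℕ := φ.closure.card

end Formula

/-- A finite discrete-time Markov chain with state set `S`, stochastic matrix `P`, initial state
`init` and state labelling `label : S → 2^AP`. -/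
structure MarkovChain (S AP : Type*) [Fintype S] where
  P : S → S → ℝ
  nonneg : ∀ s t, 0 ≤ P s t
  row_sum : ∀ s, ∑ t, P s t = 1
  init : S
  label : S → Set AP

namespace MarkovChain

variable {S AP : Type*} [Fintype S]

/-- The distribution of the successor of the state `s`. -/
noncomputable def stepPMF (M : MarkovChain S AP) (s : S) : PMF S :=
  PMF.ofFintype (fun t => ENNReal.ofReal (M.P s t)) (by
    rw [← ENNReal.ofReal_sum_of_nonneg (fun t _ => M.nonneg s t), M.row_sum s, ENNReal.ofReal_one])

/-- The infinite paths of `M` that start in the initial state. -/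
def paths (M : MarkovChain S AP) : Set (ℕ → S) :=
  {π | π 0 = M.init ∧ ∀ i, 0 < M.P (π i) (π (i + 1))}

/-- The trace of a path: its sequence of labels. -/
def trace (M : MarkovChain S AP) (π : ℕ → S) : ℕ → Set AP := fun i => M.label (π i)

variable [MeasurableSpace S] [DiscreteMeasurableSpace S]

/-- The one-step transition kernel of `M`. -/
noncomputable def stepKernel (M : MarkovChain S AP) : Kernel S S where
  toFun s := (M.stepPMF s).toMeasure
  measurable' := Measurable.of_discrete

instance (M : MarkovChain S AP) : IsMarkovKernel M.stepKernel :=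
  ⟨fun s => inferInstanceAs (IsProbabilityMeasure (M.stepPMF s).toMeasure)⟩

/-- The transition kernel at time `n`, seen as a kernel on histories: only the current state of the
history matters. -/
noncomputable def historyKernel (M : MarkovChain S AP) (n : ℕ) :
    Kernel (Finset.Iic n → S) S :=
  M.stepKernel.comap (fun h => h ⟨n, Finset.mem_Iic.2 le_rfl⟩) (measurable_pi_apply _)

instance (M : MarkovChain S AP) (n : ℕ) : IsMarkovKernel (M.historyKernel n) := by
  unfold historyKernel; infer_instance

/-- The probability measure of `M` on infinite state sequences: start in the initial state
and extend step by step with the transition probabilities. -/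
noncomputable def pathMeasure (M : MarkovChain S AP) : Measure (ℕ → S) :=
  Kernel.traj (X := fun _ => S) (fun n => M.historyKernel n) 0 (fun _ => M.init)

variable {Var : Type*}

/-- `Pr (M ⊨ v(φ))`. -/
noncomputable def prob (M : MarkovChain S AP) (v : Var → ℕ) (φ : Formula AP Var) : ENNReal :=
  M.pathMeasure {π | π ∈ M.paths ∧ φ.Sat (M.trace π) v 0}

/-- The valuation set `V_{>0}(φ)`. -/
def valuationsPos (M : MarkovChain S AP) (φ : Formula AP Var) : Set (Var → ℕ) :=
  {v | 0 < M.prob v φ}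

end MarkovChain

end PLTL

/-!
Only the forward direction has content. Let `Γ` be the closure of `φ`, let
`K = |S| · |Γ| · 2 ^ |Γ|`, and suppose that `φ` holds with positive probability under some
valuation. Since `φ` is monotone in the valuation, one may assume that all variables have the same
value `L ≥ K`, and `L` has to be replaced by `K`.

*Finite certificates.* By Lévy's zero-one law (`ae_exists_forces`), a typical path on which `ψ`
holds at all positions from some time on visits a state from which `ψ` is almost surely true at all
positions of all paths. Hence the truth of `φ` on a typical path has a finite certificate: finitely
many claims that some `ψ` holds at some position `i`, each justified by claims at `i` and `i + 1`
(`TruthRule`, `eventually_mem_trueClaims`), where a claim that `ψ` holds forever may be dropped at a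
state from which it is almost surely true forever. Conversely, such a certificate on the first `N`
states of a path is correct on almost all continuations of this prefix, which has positive
probability. The same is true of falsity (`FalsityRule`, `eventually_mem_falseClaims`), except that
the falsity of `◇_{≤ x} ψ` at `i` requires the falsity of `ψ` on a whole window of positions.

*Truth from `L` to `K`.* In a certificate of truth a claim of `◇_{≤ x} ψ` is treated like one of
`◇ ψ`. Cutting out loops between positions with the same state and the same claims shortens the
certificate to length at most `|S| · 2 ^ |Γ| ≤ K` (`IsRun.exists_short`), and then every such claim
is met within distance `K`.

*Falsity from `K` to `L`.* In a certificate of falsity with windows of length `K`, some loop inside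
each window can be repeated without shortening any window. To see this, assign to each position of
the window the state, the claims, and the number of different formulas `◇_{≤ x} ψ` claimed false
since the window began. By the choice of `K` two positions agree in this, and no such formula is
claimed for the first time between them, so that the windows of the formulas claimed there cover the
whole loop (`exists_windowed_loop`). Hence windows can be lengthened to `L`
(`exists_isRun_hasWindow`).

Certificates of truth for `K` drop claims that are almost surely true for `K`, while the typical
path provides claims that are almost surely true for `L`; passing from one to the other is the
second transfer for a smaller formula. The situation for falsity is symmetric, so both transfers are
proved by a simultaneous induction on the formula (`pathLaw_models_ne_zero_of_le`).
-/

/-! ### Paths of a finite Markov chain -/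

namespace PLTL
namespace MarkovChain
open Preorder

/-- The sequence `π` without its first `n` entries. -/
def shift {S : Type*} (n : ℕ) (π : ℕ → S) : ℕ → S := fun i => π (n + i)

theorem shift_zero {S : Type*} (π : ℕ → S) : shift 0 π = π := by
  funext i
  simp [shift]

theorem shift_shift {S : Type*} (m n : ℕ) (π : ℕ → S) :
    shift m (shift n π) = shift (n + m) π := by
  funext i
  simp [shift, Nat.add_assoc]

theorem measurable_shift {S : Type*} [MeasurableSpace S] (n : ℕ) :
    Measurable (shift n : (ℕ → S) → ℕ → S) :=
  measurable_pi_lambda _ fun i => measurable_pi_apply (n + i)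

variable {S AP : Type*} [Fintype S] [MeasurableSpace S] [DiscreteMeasurableSpace S]

/-- The law of the paths of `M` started in an arbitrary state `s`. -/
noncomputable def pathLaw (M : MarkovChain S AP) (s : S) : Measure (ℕ → S) :=
  Kernel.traj (X := fun _ => S) (fun n => M.historyKernel n) 0 (fun _ => s)

instance (M : MarkovChain S AP) (s : S) : IsProbabilityMeasure (M.pathLaw s) := by
  unfold pathLaw; infer_instance

theorem stepKernel_singleton (M : MarkovChain S AP) (s t : S) :
    M.stepKernel s {t} = ENNReal.ofReal (M.P s t) := by
  change (M.stepPMF s).toMeasure {t} = _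
  rw [PMF.toMeasure_apply_singleton _ _ (measurableSet_singleton t)]
  rfl

/-- The conditional law of the next state, on an event `A` about the states up to time `b` that
fixes the state at time `b`. -/
theorem traj_inter_succ (M : MarkovChain S AP) (n : ℕ) (h : Finset.Iic n → S) {b : ℕ}
    (hb : n ≤ b) {A : Set (Finset.Iic b → S)} {s : S}
    (hs : ∀ x ∈ A, x ⟨b, Finset.mem_Iic.2 le_rfl⟩ = s) (t : S) :
    Kernel.traj (X := fun _ => S) (fun n => M.historyKernel n) n h
        (frestrictLe b ⁻¹' A ∩ {x | x (b + 1) = t}) =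
      Kernel.traj (X := fun _ => S) (fun n => M.historyKernel n) n h (frestrictLe b ⁻¹' A) *
        ENNReal.ofReal (M.P s t) := by
  have key := Kernel.partialTraj_compProd_eq_map_traj (X := fun _ => S)
    (κ := fun n => M.historyKernel n) hb (x₀ := h)
  have hA : MeasurableSet A := MeasurableSet.of_discrete
  have ht : MeasurableSet ({t} : Set S) := measurableSet_singleton t
  have h1 := congrArg (fun μ => μ (A ×ˢ {t})) key
  rw [Measure.compProd_apply_prod hA ht, Measure.map_apply (by fun_prop) (hA.prod ht)] at h1
  have h2 : (fun x : ℕ → S => (frestrictLe (π := fun _ => S) b x, x (b + 1))) ⁻¹' (A ×ˢ {t}) =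
      frestrictLe b ⁻¹' A ∩ {x | x (b + 1) = t} := by
    ext x; simp
  rw [h2] at h1
  rw [← h1, ← Kernel.traj_map_frestrictLe_apply, ← Measure.map_apply (by fun_prop) hA]
  rw [setLIntegral_congr_fun (g := fun _ => ENNReal.ofReal (M.P s t)) hA]
  · rw [setLIntegral_const, mul_comm]
  · intro x hx
    change M.stepKernel (x ⟨b, _⟩) {t} = _
    rw [hs x hx, stepKernel_singleton]

/-- Under the law of the trajectories that extend the history `h`, the path from time `n` on starts
with the word `u 0 … u b` with the product of the transition probabilities. -/
theorem traj_cylinder (M : MarkovChain S AP) (n : ℕ) (h : Finset.Iic n → S) (u : ℕ → S)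
    (b : ℕ) (hu : u 0 = h ⟨n, Finset.mem_Iic.2 le_rfl⟩) :
    Kernel.traj (X := fun _ => S) (fun n => M.historyKernel n) n h
        {π | ∀ i ≤ b, π (n + i) = u i} =
      ∏ i ∈ Finset.range b, ENNReal.ofReal (M.P (u i) (u (i + 1))) := by
  induction b with
  | zero =>
    have h1 := congrArg (fun μ => μ {x | x ⟨n, Finset.mem_Iic.2 le_rfl⟩ = u 0})
      (Kernel.traj_map_frestrictLe_apply (X := fun _ => S) (κ := fun n => M.historyKernel n) n n h)
    simp only [Kernel.partialTraj_self, Kernel.id_apply] at h1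
    rw [Measure.map_apply (by fun_prop) MeasurableSet.of_discrete,
      Measure.dirac_apply_of_mem (by simp [hu])] at h1
    simpa using h1
  | succ b ih =>
    have := M.traj_inter_succ n h (b := n + b) (Nat.le_add_right _ _)
      (A := {x | ∀ i, ∀ hi : i ≤ b, x ⟨n + i, Finset.mem_Iic.2 (by omega)⟩ = u i}) (s := u b)
      (fun x hx => hx b le_rfl) (u (b + 1))
    rw [Finset.prod_range_succ, ← ih]
    convert! this using 2
    ext π
    simp only [Set.mem_ofPred_eq, Set.mem_inter_iff, Set.mem_preimage, frestrictLe_apply]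
    constructor
    · intro H
      exact ⟨fun i hi => H i (by omega), H (b + 1) le_rfl⟩
    · rintro ⟨H1, H2⟩ i hi
      rcases Nat.lt_or_eq_of_le hi with h' | rfl
      · exact H1 i (by omega)
      · exact H2

theorem traj_cylinder_of_ne (M : MarkovChain S AP) (n : ℕ) (h : Finset.Iic n → S) (u : ℕ → S)
    (b : ℕ) (hu : u 0 ≠ h ⟨n, Finset.mem_Iic.2 le_rfl⟩) :
    Kernel.traj (X := fun _ => S) (fun n => M.historyKernel n) n h
        {π | ∀ i ≤ b, π (n + i) = u i} = 0 := by
  refine measure_mono_null (t := {π | π n = u 0}) (fun π hπ => hπ 0 (Nat.zero_le _)) ?_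
  have h1 := congrArg (fun μ => μ {x | x ⟨n, Finset.mem_Iic.2 le_rfl⟩ = u 0})
    (Kernel.traj_map_frestrictLe_apply (X := fun _ => S) (κ := fun n => M.historyKernel n) n n h)
  simp only [Kernel.partialTraj_self, Kernel.id_apply] at h1
  rw [Measure.map_apply (by fun_prop) MeasurableSet.of_discrete,
    Measure.dirac_apply' _ MeasurableSet.of_discrete] at h1
  simpa [hu.symm] using h1

/-- Two laws on paths agree as soon as they agree on the sets of paths with a given prefix. -/
theorem ext_of_cylinder {μ ν : Measure (ℕ → S)} [IsFiniteMeasure μ]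
    (h : ∀ (u : ℕ → S) (b : ℕ), μ {π | ∀ i ≤ b, π i = u i} = ν {π | ∀ i ≤ b, π i = u i}) :
    μ = ν := by
  have key : ∀ b, μ.map (frestrictLe (π := fun _ => S) b) = ν.map (frestrictLe b) := by
    intro b
    refine Measure.ext_of_singleton fun x => ?_
    by_cases hS : Nonempty S
    · obtain ⟨s0⟩ := hS
      have : frestrictLe (π := fun _ => S) b ⁻¹' {x} = {π | ∀ i ≤ b, π i =
          (fun i => if hi : i ≤ b then x ⟨i, Finset.mem_Iic.2 hi⟩ else s0) i} := by
        ext π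
        simp only [Set.mem_preimage, Set.mem_singleton_iff, Set.mem_ofPred_eq, funext_iff]
        constructor
        · intro H i hi
          simp [hi, ← H ⟨i, Finset.mem_Iic.2 hi⟩]
        · rintro H ⟨i, hi⟩
          have hi' := Finset.mem_Iic.1 hi
          simpa [hi'] using H i hi'
      rw [Measure.map_apply (by fun_prop) (measurableSet_singleton x),
        Measure.map_apply (by fun_prop) (measurableSet_singleton x), this]
      exact h _ b
    · exact absurd ⟨x ⟨b, Finset.mem_Iic.2 le_rfl⟩⟩ hS
  have key' : ∀ I : Finset ℕ, μ.map (I.restrict (π := fun _ => S)) = ν.map I.restrict := by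
    intro I
    have hI : I ⊆ Finset.Iic (I.sup id) := fun i hi => Finset.mem_Iic.2 (Finset.le_sup (f := id) hi)
    have : (I.restrict : (ℕ → S) → (I → S)) =
      Finset.restrict₂ (π := fun _ => S) hI ∘ frestrictLe (I.sup id) := rfl
    rw [this, ← Measure.map_map (by fun_prop) (by fun_prop), key,
      Measure.map_map (by fun_prop) (by fun_prop)]
  have : ∀ I : Finset ℕ, IsFiniteMeasure (μ.map (I.restrict (π := fun _ => S))) :=
    fun I => inferInstance
  exact IsProjectiveLimit.unique (P := fun I => μ.map (I.restrict (π := fun _ => S)))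
    (fun _ => rfl) (fun I => (key' I).symm)

/-- The Markov property: whatever the history `h` up to time `n`, the path from time `n` on has the
law of a path started in the last state of `h`. -/
theorem traj_map_shift (M : MarkovChain S AP) (n : ℕ) (h : Finset.Iic n → S) :
    (Kernel.traj (X := fun _ => S) (fun n => M.historyKernel n) n h).map (shift n) =
      M.pathLaw (h ⟨n, Finset.mem_Iic.2 le_rfl⟩) := by
  have : IsFiniteMeasure ((Kernel.traj (X := fun _ => S) (fun n => M.historyKernel n) n h).map
    (shift n)) := inferInstance
  refine ext_of_cylinder fun u b => ?_
  rw [Measure.map_apply (measurable_shift n)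
    (by measurability)]
  change Kernel.traj (X := fun _ => S) (fun n => M.historyKernel n) n h
    {π | ∀ i ≤ b, π (n + i) = u i} = _
  have h0 : {π : ℕ → S | ∀ i ≤ b, π i = u i} = {π | ∀ i ≤ b, π (0 + i) = u i} := by simp
  rw [pathLaw, h0]
  by_cases hu : u 0 = h ⟨n, Finset.mem_Iic.2 le_rfl⟩
  · rw [traj_cylinder M 0 _ u b hu, traj_cylinder M n h u b hu]
  · rw [traj_cylinder_of_ne M 0 _ u b hu, traj_cylinder_of_ne M n h u b hu]

theorem pathLaw_cylinder (M : MarkovChain S AP) (u : ℕ → S) (b : ℕ) :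
    M.pathLaw (u 0) {π | ∀ i ≤ b, π i = u i} =
      ∏ i ∈ Finset.range b, ENNReal.ofReal (M.P (u i) (u (i + 1))) := by
  rw [← traj_cylinder M 0 (fun _ => u 0) u b rfl]
  simp [pathLaw]

theorem ae_pathLaw_zero (M : MarkovChain S AP) (s : S) : ∀ᵐ π ∂M.pathLaw s, π 0 = s := by
  have h := M.pathLaw_cylinder (fun _ => s) 0
  rw [Finset.range_zero, Finset.prod_empty] at h
  have h2 : ∀ᵐ π ∂M.pathLaw s, π ∈ {π : ℕ → S | ∀ i ≤ 0, π i = s} :=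
    (mem_ae_iff_prob_eq_one (by measurability)).2 h
  filter_upwards [h2] with π hπ using hπ 0 le_rfl

/-- The Markov property at time `n`, on the event that the state at time `n` is `t`. -/
theorem pathLaw_inter_shift (M : MarkovChain S AP) (s : S) (n : ℕ) (t : S) {B : Set (ℕ → S)}
    (hB : MeasurableSet B) :
    M.pathLaw s ({π | π n = t} ∩ shift n ⁻¹' B) = M.pathLaw s {π | π n = t} * M.pathLaw t B := by
  have key := Kernel.partialTraj_compProd_traj (X := fun _ => S)
    (κ := fun n => M.historyKernel n) (Nat.zero_le n) (fun _ => s)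
  set A : Set (Finset.Iic n → S) := {x | x ⟨n, Finset.mem_Iic.2 le_rfl⟩ = t}
  have hA : MeasurableSet A := MeasurableSet.of_discrete
  have hB' : MeasurableSet (shift n ⁻¹' B) := measurable_shift n hB
  have h1 := congrArg (fun μ => μ (A ×ˢ (shift n ⁻¹' B))) key
  rw [Measure.compProd_apply_prod hA hB', Measure.map_apply (by fun_prop) (hA.prod hB')] at h1
  change _ = M.pathLaw s ({π | π n = t} ∩ shift n ⁻¹' B) at h1
  rw [← h1, setLIntegral_congr_fun (g := fun _ => M.pathLaw t B) hA]
  · rw [setLIntegral_const, mul_comm, ← Kernel.traj_map_frestrictLe_apply,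
      Measure.map_apply (by fun_prop) hA]
    rfl
  · intro x hx
    change Kernel.traj (X := fun _ => S) (fun n => M.historyKernel n) n x (shift n ⁻¹' B) =
      M.pathLaw t B
    rw [← Measure.map_apply (measurable_shift n) hB, traj_map_shift]
    rw [show x ⟨n, Finset.mem_Iic.2 le_rfl⟩ = t from hx]

/-- The state `t` can be reached from the state `s`. -/
def Reachable (M : MarkovChain S AP) : S → S → Prop :=
  Relation.ReflTransGen fun s t => 0 < M.P s t

/-- Almost every path from every state that is reachable from `s` lies in `E`. -/
def Forces (M : MarkovChain S AP) (s : S) (E : Set (ℕ → S)) : Prop :=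
  ∀ t, M.Reachable s t → M.pathLaw t Eᶜ = 0

/-- Almost surely, whenever the path reaches a state from which `E` is certain, the rest of the path
lies in `E`. -/
theorem ae_shift_mem (M : MarkovChain S AP) (s : S) {E : Set (ℕ → S)} (hE : MeasurableSet E)
    (n : ℕ) : ∀ᵐ π ∂M.pathLaw s, M.pathLaw (π n) Eᶜ = 0 → shift n π ∈ E := by
  have h : ∀ t, ∀ᵐ π ∂M.pathLaw s, M.pathLaw t Eᶜ = 0 → π n = t → shift n π ∈ E := by
    intro t
    by_cases ht : M.pathLaw t Eᶜ = 0
    · have h1 := M.pathLaw_inter_shift s n t hE.compl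
      rw [ht, mul_zero] at h1
      refine measure_mono_null (fun π hπ => ?_) h1
      simp only [Set.mem_compl_iff, Set.mem_ofPred_eq] at hπ
      push Not at hπ
      exact ⟨hπ.2.1, hπ.2.2⟩
    · exact Filter.Eventually.of_forall fun π h => absurd h ht
  filter_upwards [ae_all_iff.2 h] with π hπ h0 using hπ _ h0 rfl

theorem pathLaw_one (M : MarkovChain S AP) (s t : S) :
    M.pathLaw s {π | π 1 = t} = ENNReal.ofReal (M.P s t) := by
  have h := M.pathLaw_cylinder (fun i => if i = 0 then s else t) 1
  simp only [↓reduceIte, Finset.range_one, Finset.prod_singleton, zero_add, one_ne_zero] at h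
  rw [← h]
  refine measure_congr ?_
  filter_upwards [M.ae_pathLaw_zero s] with π hπ
  refine propext ⟨fun h1 i hi => ?_, fun H => ?_⟩
  · interval_cases i
    · simpa using hπ
    · exact h1
  · have := H 1 le_rfl
    simp only [one_ne_zero, ↓reduceIte] at this
    exact this

theorem ae_pathLaw_step (M : MarkovChain S AP) (s : S) :
    ∀ᵐ π ∂M.pathLaw s, ∀ i, 0 < M.P (π i) (π (i + 1)) := by
  set E : Set (ℕ → S) := {π | 0 < M.P (π 0) (π 1)}
  have hE : MeasurableSet E := by
    have : E = (fun π : ℕ → S => (π 0, π 1)) ⁻¹' {p | 0 < M.P p.1 p.2} := rfl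
    rw [this]
    exact MeasurableSet.preimage MeasurableSet.of_discrete (by fun_prop)
  have h0 : ∀ t, M.pathLaw t Eᶜ = 0 := by
    intro t
    have h1 : ∀ r, ∀ᵐ π ∂M.pathLaw t, π 1 = r → 0 < M.P t r := by
      intro r
      by_cases hr : 0 < M.P t r
      · exact Filter.Eventually.of_forall fun π _ => hr
      · have := M.pathLaw_one t r
        rw [ENNReal.ofReal_of_nonpos (not_lt.1 hr)] at this
        refine measure_mono_null (fun π hπ => ?_) this
        simp only [Set.mem_compl_iff, Set.mem_ofPred_eq] at hπ
        push Not at hπ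
        exact hπ.1
    have : ∀ᵐ π ∂M.pathLaw t, π ∈ E := by
      filter_upwards [ae_all_iff.2 h1, M.ae_pathLaw_zero t] with π h1 h2
      change 0 < M.P (π 0) (π 1)
      rw [h2]
      exact h1 _ rfl
    exact this
  filter_upwards [ae_all_iff.2 fun n => M.ae_shift_mem s hE n] with π hπ i
  exact hπ i (h0 _)

/-- If almost every path from `s` has all its suffixes in `E`, then this is inherited by the
successors of `s`, hence by all reachable states. -/
theorem forces_of_forall_shift (M : MarkovChain S AP) {s : S} {E : Set (ℕ → S)}
    (hE : MeasurableSet E) (h : M.pathLaw s {π | ∀ j, shift j π ∈ E}ᶜ = 0) : M.Forces s E := by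
  set D : Set (ℕ → S) := {π | ∀ j, shift j π ∈ E} with hD
  have hDm : MeasurableSet D := by
    have : D = ⋂ j, shift j ⁻¹' E := by ext; simp [hD]
    rw [this]
    exact MeasurableSet.iInter fun j => measurable_shift j hE
  have key : ∀ t, M.Reachable s t → M.pathLaw t Dᶜ = 0 := by
    intro t ht
    induction ht with
    | refl => exact h
    | @tail t r _ htr ih =>
      have h1 := M.pathLaw_inter_shift t 1 r hDm.compl
      have h2 : M.pathLaw t ({π | π 1 = r} ∩ shift 1 ⁻¹' Dᶜ) = 0 := by
        refine measure_mono_null (t := Dᶜ) (fun π hπ hπD => hπ.2 fun j => ?_) ih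
        rw [shift_shift]
        exact hπD (1 + j)
      rw [h2, pathLaw_one] at h1
      rcases mul_eq_zero.1 h1.symm with h3 | h3
      · exact absurd h3 (by simpa using htr)
      · exact h3
  intro t ht
  refine measure_mono_null (t := Dᶜ) (fun π hπ hπD => hπ ?_) (key t ht)
  simpa only [shift_zero] using hπD 0

/-- If a property holds along a whole tail of a typical path, then the path visits a state from
which the property is certain. This is Lévy's zero-one law: the conditional probability, given the
first states, that the property holds forever tends to `1`, and it is bounded by one of finitely
many numbers. -/
theorem ae_exists_forces (M : MarkovChain S AP) (s : S) {E : Set (ℕ → S)} (hE : MeasurableSet E)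
    (m : ℕ) :
    ∀ᵐ π ∂M.pathLaw s, (∀ j, m ≤ j → shift j π ∈ E) → ∃ n, m ≤ n ∧ M.Forces (π n) E := by
  set D : ℕ → Set (ℕ → S) := fun m => {π | ∀ j, m ≤ j → shift j π ∈ E} with hD
  have hDm : ∀ m, MeasurableSet (D m) := by
    intro m
    have : D m = ⋂ j, ⋂ (_ : m ≤ j), shift j ⁻¹' E := by ext; simp [hD]
    rw [this]
    exact MeasurableSet.iInter fun j => MeasurableSet.iInter fun _ => measurable_shift j hE
  have hint : Integrable ((D m).indicator fun _ => (1 : ℝ)) (M.pathLaw s) :=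
    (integrable_const _).indicator (hDm m)
  have hsup : MeasurableSpace.pi ≤ ⨆ n, Filtration.piLE (X := fun _ : ℕ => S) n := by
    refine iSup_le fun n => le_iSup_of_le n ?_
    rw [Filtration.piLE_eq_comap_frestrictLe]
    have : (fun π : ℕ → S => π n) =
      (fun x : Finset.Iic n → S => x ⟨n, Finset.mem_Iic.2 le_rfl⟩) ∘ frestrictLe n := rfl
    rw [this, ← MeasurableSpace.comap_comp]
    exact MeasurableSpace.comap_mono (measurable_pi_apply _).comap_le
  have levy := hint.tendsto_ae_condExp (ℱ := Filtration.piLE (X := fun _ : ℕ => S))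
    ((stronglyMeasurable_const.indicator (hDm m)).mono hsup)
  have hcond : ∀ n, ∀ᵐ π ∂M.pathLaw s, m ≤ n →
      ((M.pathLaw s)[(D m).indicator fun _ => (1 : ℝ) | Filtration.piLE (X := fun _ : ℕ => S) n]) π
        ≤ (M.pathLaw (π n)).real (D 0) := by
    intro n
    filter_upwards [Kernel.condExp_traj (Nat.zero_le n) hint] with π hπ hn
    refine hπ.trans_le ?_
    -- The path from time `n` on has the law `M.pathLaw (π n)`.
    rw [integral_indicator_const _ (hDm m), smul_eq_mul, mul_one]
    have h1 := congrArg (fun μ => μ.real (D 0)) (M.traj_map_shift n (frestrictLe n π))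
    rw [map_measureReal_apply (measurable_shift n) (hDm 0)] at h1
    refine le_trans (measureReal_mono (s₂ := shift n ⁻¹' D 0) fun ρ hρ j _ => ?_) h1.le
    rw [shift_shift]
    exact hρ (n + j) (by omega)
  obtain ⟨c, hc, hcmax⟩ : ∃ c < 1, ∀ t, ¬ M.Forces t E → (M.pathLaw t).real (D 0) ≤ c := by
    classical
    have : Nonempty S := ⟨s⟩
    obtain ⟨t₀, ht₀⟩ := Finite.exists_max
      fun t => if M.Forces t E then 0 else (M.pathLaw t).real (D 0)
    refine ⟨_, ?_, fun t ht => by simpa [ht] using ht₀ t⟩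
    by_cases hf : M.Forces t₀ E
    · simp [hf]
    · simp only [hf, ↓reduceIte]
      refine lt_of_le_of_ne measureReal_le_one fun h1 => hf ?_
      refine M.forces_of_forall_shift hE ?_
      have h2 : {π : ℕ → S | ∀ j, shift j π ∈ E} = D 0 := by simp [hD]
      rw [h2, prob_compl_eq_zero_iff (hDm 0)]
      rw [measureReal_def] at h1
      exact (ENNReal.toReal_eq_one_iff _).1 h1
  filter_upwards [levy, ae_all_iff.2 hcond] with π hlim hle hπ
  by_contra! hno
  rw [Set.indicator_of_mem (show π ∈ D m from hπ)] at hlim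
  refine absurd (le_of_tendsto hlim ?_) (not_le.2 hc)
  filter_upwards [Filter.eventually_ge_atTop m] with n hn
  exact (hle n hn).trans (hcmax _ (hno n hn))

end MarkovChain
end PLTL

/-! ### Semantics of formulas -/

namespace PLTL
namespace Formula

variable {AP Var : Type*} {w : ℕ → Set AP} {v v' : Var → ℕ}

theorem sat_until_iff (i : ℕ) (φ ψ : Formula AP Var) :
    Sat w v i (.until φ ψ) ↔ Sat w v i ψ ∨ Sat w v i φ ∧ Sat w v (i + 1) (.until φ ψ) := by
  simp only [Sat]
  constructor
  · rintro ⟨j, hij, hj, hk⟩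
    rcases Nat.lt_or_eq_of_le hij with h | rfl
    · exact .inr ⟨hk i le_rfl h, j, h, hj, fun k h1 h2 => hk k (by omega) h2⟩
    · exact .inl hj
  · rintro (h | ⟨h, j, hij, hj, hk⟩)
    · exact ⟨i, le_rfl, h, fun k h1 h2 => by omega⟩
    · refine ⟨j, by omega, hj, fun k h1 h2 => ?_⟩
      rcases Nat.lt_or_eq_of_le h1 with h' | rfl
      · exact hk k h' h2
      · exact h

theorem sat_release_iff (i : ℕ) (φ ψ : Formula AP Var) :
    Sat w v i (release φ ψ) ↔ Sat w v i ψ ∧ (Sat w v i φ ∨ Sat w v (i + 1) (release φ ψ)) := by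
  simp only [Sat]
  constructor
  · intro H
    refine ⟨(H i le_rfl).resolve_right (by rintro ⟨k, h1, h2, -⟩; omega), ?_⟩
    by_cases h : Sat w v i φ
    · exact .inl h
    · refine .inr fun j hj => (H j (by omega)).imp_right ?_
      rintro ⟨k, h1, h2, h3⟩
      rcases Nat.lt_or_eq_of_le h1 with h' | rfl
      · exact ⟨k, h', h2, h3⟩
      · exact absurd h3 h
  · rintro ⟨h1, h2⟩ j hj
    rcases Nat.lt_or_eq_of_le hj with h' | rfl
    · rcases h2 with h2 | h2
      · exact .inr ⟨i, le_rfl, h', h2⟩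
      · exact (h2 j h').imp_right fun ⟨k, a, b, c⟩ => ⟨k, by omega, b, c⟩
    · exact .inl h1

theorem sat_box_iff (i : ℕ) (φ : Formula AP Var) :
    Sat w v i (box φ) ↔ Sat w v i φ ∧ Sat w v (i + 1) (box φ) := by
  simp only [Sat]
  constructor
  · exact fun H => ⟨H i le_rfl, fun j hj => H j (by omega)⟩
  · rintro ⟨h1, h2⟩ j hj
    rcases Nat.lt_or_eq_of_le hj with h' | rfl
    · exact h2 j h'
    · exact h1

theorem sat_diaConst_zero (i : ℕ) (φ : Formula AP Var) :
    Sat w v i (diaConst 0 φ) ↔ Sat w v i φ := by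
  simp only [Sat]
  exact ⟨fun ⟨j, h1, h2, h3⟩ => by rwa [show i = j by omega], fun h => ⟨i, le_rfl, by omega, h⟩⟩

theorem sat_diaConst_succ (i c : ℕ) (φ : Formula AP Var) :
    Sat w v i (diaConst (c + 1) φ) ↔ Sat w v i φ ∨ Sat w v (i + 1) (diaConst c φ) := by
  simp only [Sat]
  constructor
  · rintro ⟨j, h1, h2, h3⟩
    rcases Nat.lt_or_eq_of_le h1 with h' | rfl
    · exact .inr ⟨j, h', by omega, h3⟩
    · exact .inl h3
  · rintro (h | ⟨j, h1, h2, h3⟩)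
    · exact ⟨i, le_rfl, by omega, h⟩
    · exact ⟨j, by omega, by omega, h3⟩

theorem sat_boxConst_zero (i : ℕ) (φ : Formula AP Var) :
    Sat w v i (boxConst 0 φ) ↔ Sat w v i φ := by
  simp only [Sat]
  exact ⟨fun h => h i le_rfl (by omega), fun h j h1 h2 => by rwa [show j = i by omega]⟩

theorem sat_boxConst_succ (i c : ℕ) (φ : Formula AP Var) :
    Sat w v i (boxConst (c + 1) φ) ↔ Sat w v i φ ∧ Sat w v (i + 1) (boxConst c φ) := by
  simp only [Sat]
  constructor
  · exact fun H => ⟨H i le_rfl (by omega), fun j h1 h2 => H j (by omega) (by omega)⟩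
  · rintro ⟨h1, h2⟩ j h3 h4
    rcases Nat.lt_or_eq_of_le h3 with h' | rfl
    · exact h2 j h' (by omega)
    · exact h1

/-- Truth of `φ` depends only on the suffix of the word. -/
theorem sat_shift (n : ℕ) (φ : Formula AP Var) (i : ℕ) :
    Sat (fun k => w (n + k)) v i φ ↔ Sat w v (n + i) φ := by
  have hex : ∀ (i : ℕ) (p : ℕ → Prop), (∃ j, i ≤ j ∧ p (n + j)) ↔ ∃ j, n + i ≤ j ∧ p j :=
    fun i p => ⟨fun ⟨j, h1, h2⟩ => ⟨n + j, by omega, h2⟩, fun ⟨j, h1, h2⟩ =>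
      ⟨j - n, by omega, by rwa [show n + (j - n) = j by omega]⟩⟩
  have hall : ∀ (i : ℕ) (p : ℕ → Prop), (∀ j, i ≤ j → p (n + j)) ↔ ∀ j, n + i ≤ j → p j := by
    intro i p
    have := hex i fun j => ¬ p j
    simpa [not_exists] using not_congr this
  induction φ generalizing i with
  | pos a => rfl
  | neg a => rfl
  | and φ ψ h1 h2 => simp only [Sat, h1, h2]
  | or φ ψ h1 h2 => simp only [Sat, h1, h2]
  | next φ h => simp only [Sat, h, Nat.add_assoc]
  | release φ ψ h1 h2 =>
    simp only [Sat, h1, h2]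
    rw [← hall i fun j => Sat w v j ψ ∨ ∃ k, n + i ≤ k ∧ k < j ∧ Sat w v k φ]
    refine forall_congr' fun j => imp_congr_right fun _ => or_congr_right ?_
    rw [← hex i fun k => k < n + j ∧ Sat w v k φ]
    simp
  | box φ h => simp only [Sat, h]; exact hall i fun j => Sat w v j φ
  | diaVar x φ h =>
    simp only [Sat, h]
    rw [← hex i fun j => j ≤ v x + (n + i) ∧ Sat w v j φ]
    refine exists_congr fun j => and_congr_right fun _ => and_congr_left fun _ => by omega
  | diaConst c φ h =>
    simp only [Sat, h]
    rw [← hex i fun j => j ≤ c + (n + i) ∧ Sat w v j φ]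
    refine exists_congr fun j => and_congr_right fun _ => and_congr_left fun _ => by omega
  | boxConst c φ h =>
    simp only [Sat, h]
    rw [← hall i fun j => j ≤ c + (n + i) → Sat w v j φ]
    refine forall_congr' fun j => imp_congr_right fun _ => ?_
    rw [show n + j ≤ c + (n + i) ↔ j ≤ c + i by omega]
  -- The case of `until`, which is a reserved word and cannot name an alternative.
  | _ φ ψ h1 h2 =>
    simp only [Sat, h1, h2]
    rw [← hex i fun j => Sat w v j ψ ∧ ∀ k, n + i ≤ k → k < j → Sat w v k φ]
    refine exists_congr fun j => and_congr_right fun _ => and_congr_right fun _ => ?_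
    rw [← hall i fun k => k < n + j → Sat w v k φ]
    simp

theorem mem_closure_self (φ : Formula AP Var) : φ ∈ φ.closure := by
  cases φ <;> simp [closure]

/-- Truth is monotone in the values of the variables that occur in the formula. -/
theorem Sat.mono {φ : Formula AP Var} (h : ∀ x ψ, diaVar x ψ ∈ φ.closure → v x ≤ v' x) {i : ℕ}
    (hs : Sat w v i φ) : Sat w v' i φ := by
  induction φ generalizing i with
  | pos a => exact hs
  | neg a => exact hs
  | and φ ψ h1 h2 =>
    exact ⟨h1 (fun x χ hx => h x χ (by simp [closure, hx])) hs.1,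
      h2 (fun x χ hx => h x χ (by simp [closure, hx])) hs.2⟩
  | or φ ψ h1 h2 =>
    exact hs.imp (h1 (fun x χ hx => h x χ (by simp [closure, hx])))
      (h2 (fun x χ hx => h x χ (by simp [closure, hx])))
  | next φ h1 => exact h1 (fun x χ hx => h x χ (by simp [closure, hx])) hs
  | release φ ψ h1 h2 =>
    exact fun j hj => (hs j hj).imp (h2 (fun x χ hx => h x χ (by simp [closure, hx])))
      fun ⟨k, a, b, c⟩ => ⟨k, a, b, h1 (fun x χ hx => h x χ (by simp [closure, hx])) c⟩
  | box φ h1 => exact fun j hj => h1 (fun x χ hx => h x χ (by simp [closure, hx])) (hs j hj)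
  | diaVar x φ h1 =>
    obtain ⟨j, a, b, c⟩ := hs
    have := h x φ (by simp [closure])
    exact ⟨j, a, by omega, h1 (fun x χ hx => h x χ (by simp [closure, hx])) c⟩
  | diaConst c φ h1 =>
    obtain ⟨j, a, b, c⟩ := hs
    exact ⟨j, a, b, h1 (fun x χ hx => h x χ (by simp [closure, hx])) c⟩
  | boxConst c φ h1 =>
    exact fun j a b => h1 (fun x χ hx => h x χ (by simp [closure, hx])) (hs j a b)
  -- The case of `until`, which is a reserved word and cannot name an alternative.
  | _ φ ψ h1 h2 =>
    obtain ⟨j, hij, hj, hk⟩ := hs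
    exact ⟨j, hij, h2 (fun x χ hx => h x χ (by simp [closure, hx])) hj,
      fun k a b => h1 (fun x χ hx => h x χ (by simp [closure, hx])) (hk k a b)⟩

end Formula

namespace MarkovChain
variable {S AP Var : Type*} [Fintype S]

/-- The state sequences whose trace satisfies `φ` at position `0`. -/
def models (M : MarkovChain S AP) (v : Var → ℕ) (φ : Formula AP Var) : Set (ℕ → S) :=
  {π | φ.Sat (M.trace π) v 0}

theorem shift_mem_models (M : MarkovChain S AP) (v : Var → ℕ) (φ : Formula AP Var) (n : ℕ)
    (π : ℕ → S) : shift n π ∈ M.models v φ ↔ φ.Sat (M.trace π) v n :=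
  Formula.sat_shift (w := M.trace π) n φ 0

theorem reachable_of_le (M : MarkovChain S AP) {π : ℕ → S}
    (hπ : ∀ i, 0 < M.P (π i) (π (i + 1))) {i j : ℕ} (hij : i ≤ j) :
    M.Reachable (π i) (π j) := by
  induction j, hij using Nat.le_induction with
  | base => exact Relation.ReflTransGen.refl
  | succ j _ ih => exact ih.tail (hπ j)

theorem measurableSet_models [MeasurableSpace S] [DiscreteMeasurableSpace S]
    (M : MarkovChain S AP) (v : Var → ℕ) (φ : Formula AP Var) :
    MeasurableSet (M.models v φ) := by
  have key : ∀ i, Measurable fun π : ℕ → S => φ.Sat (M.trace π) v i := by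
    induction φ with
    | pos a =>
      intro i
      exact (Measurable.of_discrete (f := fun s => a ∈ M.label s)).comp (measurable_pi_apply i)
    | neg a =>
      intro i
      exact (Measurable.of_discrete (f := fun s => a ∉ M.label s)).comp (measurable_pi_apply i)
    | and φ ψ h1 h2 => exact fun i => (h1 i).and (h2 i)
    | or φ ψ h1 h2 => exact fun i => (h1 i).or (h2 i)
    | next φ h => exact fun i => h (i + 1)
    | release φ ψ h1 h2 =>
      exact fun i => Measurable.forall fun j => .imp measurable_const (.or (h2 j)
        (.exists fun k => .and measurable_const (.and measurable_const (h1 k))))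
    | box φ h => exact fun i => Measurable.forall fun j => .imp measurable_const (h j)
    | diaVar x φ h =>
      exact fun i => Measurable.exists fun j => .and measurable_const (.and measurable_const (h j))
    | diaConst c φ h =>
      exact fun i => Measurable.exists fun j => .and measurable_const (.and measurable_const (h j))
    | boxConst c φ h =>
      exact fun i => Measurable.forall fun j => .imp measurable_const (.imp measurable_const (h j))
    -- The case of `until`, which is a reserved word and cannot name an alternative.
    | _ φ ψ h1 h2 =>
      exact fun i => Measurable.exists fun j => .and measurable_const (.and (h2 j)
        (.forall fun k => .imp measurable_const (.imp measurable_const (h1 k))))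
  exact measurableSet_setOfPred.2 (key 0)

end MarkovChain
end PLTL

/-! ### Claims and their local rules -/

namespace PLTL
namespace Formula

variable {AP Var : Type*} {w : ℕ → Set AP} {v : Var → ℕ}

/-- One-step obligations for the truth of a formula: `A` is the current letter, `T` and `T'` are the
sets of formulas claimed true now and at the next position, and `F` is a set of formulas that are
known to be true at all positions from now on. A claim of `◇_{≤ x} φ` is treated like a claim of
`◇ φ`: no distance is recorded. -/
def TruthRule (A : Set AP) (F T T' : Set (Formula AP Var)) : Formula AP Var → Prop
  | pos a => a ∈ A
  | neg a => a ∉ A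
  | and φ ψ => φ ∈ T ∧ ψ ∈ T
  | or φ ψ => φ ∈ T ∨ ψ ∈ T
  | next φ => φ ∈ T'
  | .until φ ψ => ψ ∈ T ∨ φ ∈ T ∧ .until φ ψ ∈ T'
  | release φ ψ => ψ ∈ F ∨ ψ ∈ T ∧ (φ ∈ T ∨ release φ ψ ∈ T')
  | box φ => φ ∈ F ∨ φ ∈ T ∧ box φ ∈ T'
  | diaVar x φ => φ ∈ T ∨ diaVar x φ ∈ T'
  | diaConst 0 φ => φ ∈ T
  | diaConst (c + 1) φ => φ ∈ T ∨ diaConst c φ ∈ T'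
  | boxConst 0 φ => φ ∈ T
  | boxConst (c + 1) φ => φ ∈ T ∧ boxConst c φ ∈ T'

/-- One-step obligations for the falsity of a formula, dual to `TruthRule`: `T` and `T'` are the
sets of formulas claimed false now and at the next position, and `F` is a set of formulas that are
known to be false at all positions from now on. The obligations of `◇_{≤ x} φ` are not local; they
are the subject of `HasWindow`. -/
def FalsityRule (A : Set AP) (F T T' : Set (Formula AP Var)) : Formula AP Var → Prop
  | pos a => a ∉ A
  | neg a => a ∈ A
  | and φ ψ => φ ∈ T ∨ ψ ∈ T
  | or φ ψ => φ ∈ T ∧ ψ ∈ T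
  | next φ => φ ∈ T'
  | .until φ ψ => ψ ∈ F ∨ ψ ∈ T ∧ (φ ∈ T ∨ .until φ ψ ∈ T')
  | release φ ψ => ψ ∈ T ∨ φ ∈ T ∧ release φ ψ ∈ T'
  | box φ => φ ∈ T ∨ box φ ∈ T'
  | diaVar _ _ => True
  | diaConst 0 φ => φ ∈ T
  | diaConst (c + 1) φ => φ ∈ T ∧ diaConst c φ ∈ T'
  | boxConst 0 φ => φ ∈ T
  | boxConst (c + 1) φ => φ ∈ T ∨ boxConst c φ ∈ T'

/-- If some `◇_{≤ x} φ` is claimed false at position `i`, then `φ` is claimed false at all positions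
up to `K + i`. -/
def HasWindow (K : ℕ) (T : ℕ → Set (Formula AP Var)) (i : ℕ) : Prop :=
  ∀ x φ, diaVar x φ ∈ T i → ∀ j, i ≤ j → j ≤ K + i → φ ∈ T j

theorem TruthRule.mono {A : Set AP} {F T₁ T₂ T₁' T₂' : Set (Formula AP Var)} (h : T₁ ⊆ T₂)
    (h' : T₁' ⊆ T₂') {χ : Formula AP Var} (hχ : TruthRule A F T₁ T₁' χ) :
    TruthRule A F T₂ T₂' χ := by
  cases χ with
  | pos a => exact hχ
  | neg a => exact hχ
  | and φ ψ => exact ⟨h hχ.1, h hχ.2⟩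
  | or φ ψ => exact hχ.imp (@h _) (@h _)
  | next φ => exact h' hχ
  | release φ ψ => exact hχ.imp_right fun ⟨a, b⟩ => ⟨h a, b.imp (@h _) (@h' _)⟩
  | box φ => exact hχ.imp_right fun ⟨a, b⟩ => ⟨h a, h' b⟩
  | diaVar x φ => exact hχ.imp (@h _) (@h' _)
  | diaConst c φ =>
    cases c with
    | zero => exact h hχ
    | succ c => exact hχ.imp (@h _) (@h' _)
  | boxConst c φ =>
    cases c with
    | zero => exact h hχ
    | succ c => exact ⟨h hχ.1, h' hχ.2⟩
  -- The case of `until`, which is a reserved word and cannot name an alternative.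
  | _ φ ψ => exact hχ.imp (@h _) fun ⟨a, b⟩ => ⟨h a, h' b⟩

theorem FalsityRule.mono {A : Set AP} {F T₁ T₂ T₁' T₂' : Set (Formula AP Var)} (h : T₁ ⊆ T₂)
    (h' : T₁' ⊆ T₂') {χ : Formula AP Var} (hχ : FalsityRule A F T₁ T₁' χ) :
    FalsityRule A F T₂ T₂' χ := by
  cases χ with
  | pos a => exact hχ
  | neg a => exact hχ
  | and φ ψ => exact hχ.imp (@h _) (@h _)
  | or φ ψ => exact ⟨h hχ.1, h hχ.2⟩
  | next φ => exact h' hχ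
  | release φ ψ => exact hχ.imp (@h _) fun ⟨a, b⟩ => ⟨h a, h' b⟩
  | box φ => exact hχ.imp (@h _) (@h' _)
  | diaVar x φ => trivial
  | diaConst c φ =>
    cases c with
    | zero => exact h hχ
    | succ c => exact ⟨h hχ.1, h' hχ.2⟩
  | boxConst c φ =>
    cases c with
    | zero => exact h hχ
    | succ c => exact hχ.imp (@h _) (@h' _)
  -- The case of `until`, which is a reserved word and cannot name an alternative.
  | _ φ ψ => exact hχ.imp_right fun ⟨a, b⟩ => ⟨h a, b.imp (@h _) (@h' _)⟩

theorem backward_induction {p : ℕ → Prop} {N : ℕ} (h : ∀ i, N ≤ i → p i)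
    (hs : ∀ i, p (i + 1) → p i) (i : ℕ) : p i := by
  rcases Nat.le_total N i with hi | hi
  · exact h i hi
  · exact Nat.decreasingInduction' (fun k _ _ => hs k) hi (h N le_rfl)

/-- Claims of truth that obey `TruthRule` and are made at the first `N` positions only are correct
when the variables have the value `K ≥ N`. -/
theorem sat_of_truthRule {F T : ℕ → Set (Formula AP Var)} {N K : ℕ} (hN : ∀ i, N ≤ i → T i = ∅)
    (hT : ∀ i, ∀ χ ∈ T i, TruthRule (w i) (F i) (T i) (T (i + 1)) χ)
    (hF : ∀ i, ∀ χ ∈ F i, i < N → ∀ j, i ≤ j → Sat w (fun _ : Var => K) j χ) (hK : N ≤ K)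
    {χ : Formula AP Var} {i : ℕ} (hχ : χ ∈ T i) : Sat w (fun _ : Var => K) i χ := by
  have hlt : ∀ {i χ}, χ ∈ T i → i < N := by
    intro i χ h
    by_contra hi
    rw [hN i (not_lt.1 hi)] at h
    exact h
  have down : ∀ χ, (∀ i, (χ ∈ T (i + 1) → Sat w (fun _ : Var => K) (i + 1) χ) →
      χ ∈ T i → Sat w (fun _ : Var => K) i χ) → ∀ i, χ ∈ T i → Sat w (fun _ : Var => K) i χ := by
    intro χ hs
    exact backward_induction (fun i hi h => absurd (hlt h) (not_lt.2 hi)) hs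
  induction χ generalizing i with
  | pos a => exact hT i _ hχ
  | neg a => exact hT i _ hχ
  | and φ ψ h1 h2 => exact ⟨h1 (hT i _ hχ).1, h2 (hT i _ hχ).2⟩
  | or φ ψ h1 h2 => exact (hT i _ hχ).imp h1 h2
  | next φ h => exact h (i := i + 1) (hT i _ hχ)
  | release φ ψ h1 h2 =>
    refine down _ (fun i ih h => ?_) i hχ
    rcases hT i _ h with h3 | ⟨h3, h4⟩
    · exact fun j hj => .inl (hF i _ h3 (hlt h) j hj)
    · exact (sat_release_iff _ _ _).2 ⟨h2 h3, h4.imp h1 ih⟩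
  | box φ h1 =>
    refine down _ (fun i ih h => ?_) i hχ
    rcases hT i _ h with h3 | ⟨h3, h4⟩
    · exact hF i _ h3 (hlt h)
    · exact (sat_box_iff _ _).2 ⟨h1 h3, ih h4⟩
  | diaVar x φ h1 =>
    -- The claim is handed on until it is met, which happens before position `N`.
    have key : ∀ i, diaVar x φ ∈ T i → ∃ j, i ≤ j ∧ φ ∈ T j := by
      refine backward_induction (N := N) (fun i hi h => absurd (hlt h) (not_lt.2 hi))
        fun i ih h => ?_
      rcases hT i _ h with h3 | h3
      · exact ⟨i, le_rfl, h3⟩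
      · obtain ⟨j, hj, h4⟩ := ih h3
        exact ⟨j, by omega, h4⟩
    obtain ⟨j, hj, h3⟩ := key i hχ
    have := hlt h3
    exact ⟨j, hj, show j ≤ K + i by omega, h1 h3⟩
  | diaConst c φ h1 =>
    induction c generalizing i with
    | zero => exact (sat_diaConst_zero _ _).2 (h1 (hT i _ hχ))
    | succ c ih => exact (sat_diaConst_succ _ _ _).2 ((hT i _ hχ).imp h1 ih)
  | boxConst c φ h1 =>
    induction c generalizing i with
    | zero => exact (sat_boxConst_zero _ _).2 (h1 (hT i _ hχ))
    | succ c ih => exact (sat_boxConst_succ _ _ _).2 ⟨h1 (hT i _ hχ).1, ih (hT i _ hχ).2⟩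
  -- The case of `until`, which is a reserved word and cannot name an alternative.
  | _ φ ψ h1 h2 =>
    refine down _ (fun i ih h => ?_) i hχ
    exact (sat_until_iff _ _ _).2 ((hT i _ h).imp h2 fun ⟨h3, h4⟩ => ⟨h1 h3, ih h4⟩)

/-- Claims of falsity that obey `FalsityRule`, have windows of length `K` and are made at the first
`N` positions only are correct when the variables have the value `K`. -/
theorem not_sat_of_falsityRule {F T : ℕ → Set (Formula AP Var)} {N K : ℕ}
    (hN : ∀ i, N ≤ i → T i = ∅)
    (hT : ∀ i, ∀ χ ∈ T i, FalsityRule (w i) (F i) (T i) (T (i + 1)) χ)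
    (hF : ∀ i, ∀ χ ∈ F i, i < N → ∀ j, i ≤ j → ¬ Sat w (fun _ : Var => K) j χ)
    (hK : ∀ i, HasWindow K T i)
    {χ : Formula AP Var} {i : ℕ} (hχ : χ ∈ T i) : ¬ Sat w (fun _ : Var => K) i χ := by
  have hlt : ∀ {i χ}, χ ∈ T i → i < N := by
    intro i χ h
    by_contra hi
    rw [hN i (not_lt.1 hi)] at h
    exact h
  have down : ∀ χ, (∀ i, (χ ∈ T (i + 1) → ¬ Sat w (fun _ : Var => K) (i + 1) χ) →
      χ ∈ T i → ¬ Sat w (fun _ : Var => K) i χ) →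
      ∀ i, χ ∈ T i → ¬ Sat w (fun _ : Var => K) i χ := by
    intro χ hs
    exact backward_induction (fun i hi h => absurd (hlt h) (not_lt.2 hi)) hs
  induction χ generalizing i with
  | pos a => exact hT i _ hχ
  | neg a => exact not_not_intro (hT i _ hχ)
  | and φ ψ h1 h2 => exact fun h => (hT i _ hχ).elim (h1 · h.1) (h2 · h.2)
  | or φ ψ h1 h2 => exact fun h => h.elim (h1 (hT i _ hχ).1) (h2 (hT i _ hχ).2)
  | next φ h => exact h (i := i + 1) (hT i _ hχ)
  | release φ ψ h1 h2 =>
    refine down _ (fun i ih h => ?_) i hχ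
    rw [sat_release_iff]
    rintro ⟨h5, h6⟩
    rcases hT i _ h with h3 | ⟨h3, h4⟩
    · exact h2 h3 h5
    · exact h6.elim (h1 h3) (ih h4)
  | box φ h1 =>
    refine down _ (fun i ih h => ?_) i hχ
    rw [sat_box_iff]
    rintro ⟨h5, h6⟩
    exact (hT i _ h).elim (h1 · h5) (ih · h6)
  | diaVar x φ h1 =>
    rintro ⟨j, hj, hj', h⟩
    exact h1 (hK i x φ hχ j hj hj') h
  | diaConst c φ h1 =>
    induction c generalizing i with
    | zero => exact fun h => h1 (hT i _ hχ) ((sat_diaConst_zero _ _).1 h)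
    | succ c ih =>
      exact fun h => ((sat_diaConst_succ _ _ _).1 h).elim (h1 (hT i _ hχ).1) (ih (hT i _ hχ).2)
  | boxConst c φ h1 =>
    induction c generalizing i with
    | zero => exact fun h => h1 (hT i _ hχ) ((sat_boxConst_zero _ _).1 h)
    | succ c ih =>
      intro h
      rw [sat_boxConst_succ] at h
      exact (hT i _ hχ).elim (h1 · h.1) (ih · h.2)
  -- The case of `until`, which is a reserved word and cannot name an alternative.
  | _ φ ψ h1 h2 =>
    refine down _ (fun i ih h => ?_) i hχ
    rcases hT i _ h with h3 | ⟨h3, h4⟩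
    · rintro ⟨j, hj, h5, -⟩
      exact hF i _ h3 (hlt h) j hj h5
    · rw [sat_until_iff]
      rintro (h5 | ⟨h5, h6⟩)
      · exact h2 h3 h5
      · exact h4.elim (h1 · h5) (ih · h6)

/-- For a monotone rule `Q`, the operator that keeps the claims in `Γ` at positions below `N` that
`Q` justifies. -/
def claimOp (Γ : Set (Formula AP Var))
    (Q : (ℕ → Set (Formula AP Var)) → ℕ → Formula AP Var → Prop)
    (hQ : ∀ T₁ T₂, T₁ ≤ T₂ → ∀ i χ, Q T₁ i χ → Q T₂ i χ) (N : ℕ) :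
    (ℕ → Set (Formula AP Var)) →o (ℕ → Set (Formula AP Var)) where
  toFun T i := {χ | χ ∈ Γ ∧ i < N ∧ Q T i χ}
  monotone' T₁ T₂ h i _ hχ := ⟨hχ.1, hχ.2.1, hQ T₁ T₂ h i _ hχ.2.2⟩

theorem mem_gfp_claimOp {Γ : Set (Formula AP Var)}
    {Q : (ℕ → Set (Formula AP Var)) → ℕ → Formula AP Var → Prop}
    {hQ : ∀ T₁ T₂, T₁ ≤ T₂ → ∀ i χ, Q T₁ i χ → Q T₂ i χ} {N i : ℕ} {χ : Formula AP Var} :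
    χ ∈ (claimOp Γ Q hQ N).gfp i ↔ χ ∈ Γ ∧ i < N ∧ Q (claimOp Γ Q hQ N).gfp i χ := by
  conv_lhs => rw [← OrderHom.map_gfp]
  rfl

/-- The largest family of claims of truth about the word `w`, within `Γ` and before position `N`,
that obeys `TruthRule`. -/
def trueClaims (Γ : Set (Formula AP Var)) (w : ℕ → Set AP) (F : ℕ → Set (Formula AP Var))
    (N : ℕ) : ℕ → Set (Formula AP Var) :=
  (claimOp Γ (fun T i => TruthRule (w i) (F i) (T i) (T (i + 1)))
    (fun _ _ h i _ => TruthRule.mono (h i) (h (i + 1))) N).gfp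

/-- The largest family of claims of falsity about the word `w`, within `Γ` and before position `N`,
that obeys `FalsityRule` and has windows of length `K`. -/
def falseClaims (Γ : Set (Formula AP Var)) (w : ℕ → Set AP) (F : ℕ → Set (Formula AP Var))
    (K N : ℕ) : ℕ → Set (Formula AP Var) :=
  (claimOp Γ (fun T i χ => FalsityRule (w i) (F i) (T i) (T (i + 1)) χ ∧
      ∀ x φ, diaVar x φ = χ → ∀ j, i ≤ j → j ≤ K + i → φ ∈ T j)
    (fun _ _ h i _ hχ => ⟨hχ.1.mono (h i) (h (i + 1)),
      fun x φ he j hj hj' => h j (hχ.2 x φ he j hj hj')⟩) N).gfp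

theorem mem_trueClaims {Γ : Set (Formula AP Var)} {F : ℕ → Set (Formula AP Var)} {N i : ℕ}
    {χ : Formula AP Var} : χ ∈ trueClaims Γ w F N i ↔ χ ∈ Γ ∧ i < N ∧
      TruthRule (w i) (F i) (trueClaims Γ w F N i) (trueClaims Γ w F N (i + 1)) χ :=
  mem_gfp_claimOp

theorem mem_falseClaims {Γ : Set (Formula AP Var)} {F : ℕ → Set (Formula AP Var)} {K N i : ℕ}
    {χ : Formula AP Var} : χ ∈ falseClaims Γ w F K N i ↔ χ ∈ Γ ∧ i < N ∧
      FalsityRule (w i) (F i) (falseClaims Γ w F K N i) (falseClaims Γ w F K N (i + 1)) χ ∧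
      ∀ x φ, diaVar x φ = χ → ∀ j, i ≤ j → j ≤ K + i → φ ∈ falseClaims Γ w F K N j :=
  mem_gfp_claimOp

open Filter

theorem closure_diaConst_subset (c : ℕ) (φ : Formula AP Var) :
    (diaConst c φ).closure ⊆ (diaConst (c + 1) φ).closure := by
  intro θ h
  simp only [closure, Finset.mem_union, Finset.mem_image, Finset.mem_range] at h ⊢
  exact h.imp_left fun ⟨j, hj, he⟩ => ⟨j, by omega, he⟩

theorem closure_boxConst_subset (c : ℕ) (φ : Formula AP Var) :
    (boxConst c φ).closure ⊆ (boxConst (c + 1) φ).closure := by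
  intro θ h
  simp only [closure, Finset.mem_union, Finset.mem_image, Finset.mem_range] at h ⊢
  exact h.imp_left fun ⟨j, hj, he⟩ => ⟨j, by omega, he⟩

/-- Every true formula is eventually among the claims of truth, provided that formulas of size
below `n` which stay true forever are recorded in `F` at some later position. -/
theorem eventually_mem_trueClaims {Γ : Set (Formula AP Var)} {F : ℕ → Set (Formula AP Var)} {n : ℕ}
    (hF : ∀ ψ : Formula AP Var, (∀ θ ∈ ψ.closure, θ ∈ Γ) → sizeOf ψ < n → ∀ i,
      (∀ j, i ≤ j → Sat w v j ψ) → ∃ k, i ≤ k ∧ ψ ∈ F k)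
    {χ : Formula AP Var} (hχ : ∀ θ ∈ χ.closure, θ ∈ Γ) (hn : sizeOf χ ≤ n) {i : ℕ}
    (hs : Sat w v i χ) : ∀ᶠ N in atTop, χ ∈ trueClaims Γ w F N i := by
  have fold : ∀ {i N χ}, (∀ θ ∈ closure χ, θ ∈ Γ) → i < N → TruthRule (w i) (F i)
      (trueClaims Γ w F N i) (trueClaims Γ w F N (i + 1)) χ → χ ∈ trueClaims Γ w F N i :=
    fun h hN hr => mem_trueClaims.2 ⟨h _ (mem_closure_self _), hN, hr⟩
  induction χ generalizing i with
  | pos a =>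
    filter_upwards [eventually_gt_atTop i] with N hN using fold hχ hN hs
  | neg a =>
    filter_upwards [eventually_gt_atTop i] with N hN using fold hχ hN hs
  | and φ ψ h1 h2 =>
    replace h1 := fun i => @h1 (fun θ h => hχ θ (by simp [closure, h])) (by simp at hn; omega) i
    replace h2 := fun i => @h2 (fun θ h => hχ θ (by simp [closure, h])) (by simp at hn; omega) i
    filter_upwards [eventually_gt_atTop i, h1 i hs.1, h2 i hs.2] with N hN a b
    exact fold hχ hN ⟨a, b⟩
  | or φ ψ h1 h2 =>
    replace h1 := fun i => @h1 (fun θ h => hχ θ (by simp [closure, h])) (by simp at hn; omega) i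
    replace h2 := fun i => @h2 (fun θ h => hχ θ (by simp [closure, h])) (by simp at hn; omega) i
    rcases hs with hs | hs
    · filter_upwards [eventually_gt_atTop i, h1 i hs] with N hN a using fold hχ hN (.inl a)
    · filter_upwards [eventually_gt_atTop i, h2 i hs] with N hN a using fold hχ hN (.inr a)
  | next φ h1 =>
    replace h1 := fun i => @h1 (fun θ h => hχ θ (by simp [closure, h])) (by simp at hn; omega) i
    filter_upwards [eventually_gt_atTop i, h1 (i + 1) hs] with N hN a using fold hχ hN a
  | release φ ψ h1 h2 =>
    replace h1 := fun i => @h1 (fun θ h => hχ θ (by simp [closure, h])) (by simp at hn; omega) i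
    replace h2 := fun i => @h2 (fun θ h => hχ θ (by simp [closure, h])) (by simp at hn; omega) i
    by_cases hall : ∀ j, i ≤ j → Sat w v j ψ
    · obtain ⟨k, hik, hk⟩ := hF ψ (fun θ h => hχ θ (by simp [closure, h])) (by simp at hn; omega)
        i hall
      have hev : ∀ᶠ N in atTop, ∀ j ∈ Finset.Icc i k, ψ ∈ trueClaims Γ w F N j :=
        (eventually_all_finset _).2 fun j hj => h2 j (hall j (Finset.mem_Icc.1 hj).1)
      filter_upwards [eventually_gt_atTop k, hev] with N hN a
      exact Nat.decreasingInduction' (P := fun j => release φ ψ ∈ trueClaims Γ w F N j)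
        (fun j hj hij ih => fold hχ (by omega)
          (.inr ⟨a j (Finset.mem_Icc.2 ⟨hij, hj.le⟩), .inr ih⟩)) hik (fold hχ hN (.inl hk))
    · -- The first position at which `φ` holds releases `ψ`.
      have hex : ∃ k, i ≤ k ∧ Sat w v k φ := by
        push Not at hall
        obtain ⟨j, hj, hj'⟩ := hall
        obtain ⟨k, h3, -, h5⟩ := (hs j hj).resolve_left hj'
        exact ⟨k, h3, h5⟩
      classical
      obtain ⟨hik, hk⟩ := Nat.find_spec hex
      have hmin : ∀ j, i ≤ j → j < Nat.find hex → ¬ Sat w v j φ :=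
        fun j hj hlt h => Nat.find_min hex hlt ⟨hj, h⟩
      generalize Nat.find hex = k at hik hk hmin
      have hψ : ∀ j, i ≤ j → j ≤ k → Sat w v j ψ := fun j hj hjk =>
        (hs j hj).resolve_right fun ⟨l, h3, h4, h5⟩ => hmin l h3 (by omega) h5
      have hev : ∀ᶠ N in atTop, ∀ j ∈ Finset.Icc i k, ψ ∈ trueClaims Γ w F N j :=
        (eventually_all_finset _).2 fun j hj =>
          h2 j (hψ j (Finset.mem_Icc.1 hj).1 (Finset.mem_Icc.1 hj).2)
      filter_upwards [eventually_gt_atTop k, hev, h1 k hk] with N hN a b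
      exact Nat.decreasingInduction' (P := fun j => release φ ψ ∈ trueClaims Γ w F N j)
        (fun j hj hij ih => fold hχ (by omega)
          (.inr ⟨a j (Finset.mem_Icc.2 ⟨hij, hj.le⟩), .inr ih⟩)) hik
        (fold hχ hN (.inr ⟨a k (Finset.mem_Icc.2 ⟨hik, le_rfl⟩), .inl b⟩))
  | box φ h1 =>
    replace h1 := fun i => @h1 (fun θ h => hχ θ (by simp [closure, h])) (by simp at hn; omega) i
    obtain ⟨k, hik, hk⟩ := hF φ (fun θ h => hχ θ (by simp [closure, h])) (by simp at hn; omega)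
      i hs
    have hev : ∀ᶠ N in atTop, ∀ j ∈ Finset.Icc i k, φ ∈ trueClaims Γ w F N j :=
      (eventually_all_finset _).2 fun j hj => h1 j (hs j (Finset.mem_Icc.1 hj).1)
    filter_upwards [eventually_gt_atTop k, hev] with N hN a
    exact Nat.decreasingInduction' (P := fun j => box φ ∈ trueClaims Γ w F N j)
      (fun j hj hij ih => fold hχ (by omega) (.inr ⟨a j (Finset.mem_Icc.2 ⟨hij, hj.le⟩), ih⟩))
      hik (fold hχ hN (.inl hk))
  | diaVar x φ h1 =>
    replace h1 := fun i => @h1 (fun θ h => hχ θ (by simp [closure, h])) (by simp at hn; omega) i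
    obtain ⟨k, hik, -, hk⟩ := hs
    filter_upwards [eventually_gt_atTop k, h1 k hk] with N hN a
    exact Nat.decreasingInduction' (P := fun j => diaVar x φ ∈ trueClaims Γ w F N j)
      (fun j hj hij ih => fold hχ (by omega) (.inr ih)) hik (fold hχ hN (.inl a))
  | diaConst c φ h1 =>
    replace h1 := fun i => @h1 (fun θ h => hχ θ (by simp [closure, h])) (by simp at hn; omega) i
    induction c generalizing i with
    | zero =>
      rw [sat_diaConst_zero] at hs
      filter_upwards [eventually_gt_atTop i, h1 i hs] with N hN a using fold hχ hN a
    | succ c ih =>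
      rcases (sat_diaConst_succ _ _ _).1 hs with hs | hs
      · filter_upwards [eventually_gt_atTop i, h1 i hs] with N hN a using fold hχ hN (.inl a)
      · have := ih (fun θ h => hχ θ (closure_diaConst_subset c φ h)) (by simp at hn ⊢; omega) hs
        filter_upwards [eventually_gt_atTop i, this] with N hN a using fold hχ hN (.inr a)
  | boxConst c φ h1 =>
    replace h1 := fun i => @h1 (fun θ h => hχ θ (by simp [closure, h])) (by simp at hn; omega) i
    induction c generalizing i with
    | zero =>
      rw [sat_boxConst_zero] at hs
      filter_upwards [eventually_gt_atTop i, h1 i hs] with N hN a using fold hχ hN a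
    | succ c ih =>
      obtain ⟨hs, hs'⟩ := (sat_boxConst_succ _ _ _).1 hs
      have := ih (fun θ h => hχ θ (closure_boxConst_subset c φ h)) (by simp at hn ⊢; omega) hs'
      filter_upwards [eventually_gt_atTop i, h1 i hs, this] with N hN a b
      exact fold hχ hN ⟨a, b⟩
  -- The case of `until`, which is a reserved word and cannot name an alternative.
  | _ φ ψ h1 h2 =>
    replace h1 := fun i => @h1 (fun θ h => hχ θ (by simp [closure, h])) (by simp at hn; omega) i
    replace h2 := fun i => @h2 (fun θ h => hχ θ (by simp [closure, h])) (by simp at hn; omega) i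
    obtain ⟨k, hik, hk, hφ⟩ := hs
    have hev : ∀ᶠ N in atTop, ∀ j ∈ Finset.Ico i k, φ ∈ trueClaims Γ w F N j :=
      (eventually_all_finset _).2 fun j hj =>
        h1 j (hφ j (Finset.mem_Ico.1 hj).1 (Finset.mem_Ico.1 hj).2)
    filter_upwards [eventually_gt_atTop k, hev, h2 k hk] with N hN a b
    exact Nat.decreasingInduction' (P := fun j => Formula.until φ ψ ∈ trueClaims Γ w F N j)
      (fun j hj hij ih => fold hχ (by omega) (.inr ⟨a j (Finset.mem_Ico.2 ⟨hij, hj⟩), ih⟩))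
      hik (fold hχ hN (.inl b))

/-- Every false formula is eventually among the claims of falsity, provided that formulas of size
below `n` which stay false forever are recorded in `F` at some later position. -/
theorem eventually_mem_falseClaims {Γ : Set (Formula AP Var)} {F : ℕ → Set (Formula AP Var)}
    {K n : ℕ}
    (hF : ∀ ψ : Formula AP Var, (∀ θ ∈ ψ.closure, θ ∈ Γ) → sizeOf ψ < n → ∀ i,
      (∀ j, i ≤ j → ¬ Sat w (fun _ : Var => K) j ψ) → ∃ k, i ≤ k ∧ ψ ∈ F k)
    {χ : Formula AP Var} (hχ : ∀ θ ∈ χ.closure, θ ∈ Γ) (hn : sizeOf χ ≤ n) {i : ℕ}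
    (hs : ¬ Sat w (fun _ : Var => K) i χ) : ∀ᶠ N in atTop, χ ∈ falseClaims Γ w F K N i := by
  have fold : ∀ {i N χ}, (∀ θ ∈ closure χ, θ ∈ Γ) → i < N → (∀ x φ, diaVar x φ ≠ χ) →
      FalsityRule (w i) (F i) (falseClaims Γ w F K N i) (falseClaims Γ w F K N (i + 1)) χ →
      χ ∈ falseClaims Γ w F K N i :=
    fun h hN hne hr => mem_falseClaims.2
      ⟨h _ (mem_closure_self _), hN, hr, fun x φ he => absurd he (hne x φ)⟩
  induction χ generalizing i with
  | pos a =>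
    filter_upwards [eventually_gt_atTop i] with N hN using fold hχ hN (by simp) hs
  | neg a =>
    filter_upwards [eventually_gt_atTop i] with N hN
    exact fold hχ hN (by simp) (not_not.1 hs)
  | and φ ψ h1 h2 =>
    replace h1 := fun i => @h1 (fun θ h => hχ θ (by simp [closure, h])) (by simp at hn; omega) i
    replace h2 := fun i => @h2 (fun θ h => hχ θ (by simp [closure, h])) (by simp at hn; omega) i
    rcases not_and_or.1 hs with hs | hs
    · filter_upwards [eventually_gt_atTop i, h1 i hs] with N hN a
      exact fold hχ hN (by simp) (.inl a)
    · filter_upwards [eventually_gt_atTop i, h2 i hs] with N hN a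
      exact fold hχ hN (by simp) (.inr a)
  | or φ ψ h1 h2 =>
    replace h1 := fun i => @h1 (fun θ h => hχ θ (by simp [closure, h])) (by simp at hn; omega) i
    replace h2 := fun i => @h2 (fun θ h => hχ θ (by simp [closure, h])) (by simp at hn; omega) i
    obtain ⟨hs, hs'⟩ := not_or.1 hs
    filter_upwards [eventually_gt_atTop i, h1 i hs, h2 i hs'] with N hN a b
    exact fold hχ hN (by simp) ⟨a, b⟩
  | next φ h1 =>
    replace h1 := fun i => @h1 (fun θ h => hχ θ (by simp [closure, h])) (by simp at hn; omega) i
    filter_upwards [eventually_gt_atTop i, h1 (i + 1) hs] with N hN a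
    exact fold hχ hN (by simp) a
  | release φ ψ h1 h2 =>
    replace h1 := fun i => @h1 (fun θ h => hχ θ (by simp [closure, h])) (by simp at hn; omega) i
    replace h2 := fun i => @h2 (fun θ h => hχ θ (by simp [closure, h])) (by simp at hn; omega) i
    simp only [Sat, not_forall, not_or, not_exists, not_and] at hs
    obtain ⟨k, hik, hk, hφ⟩ := hs
    have hev : ∀ᶠ N in atTop, ∀ j ∈ Finset.Ico i k, φ ∈ falseClaims Γ w F K N j :=
      (eventually_all_finset _).2 fun j hj =>
        h1 j (hφ j (Finset.mem_Ico.1 hj).1 (Finset.mem_Ico.1 hj).2)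
    filter_upwards [eventually_gt_atTop k, hev, h2 k hk] with N hN a b
    exact Nat.decreasingInduction' (P := fun j => release φ ψ ∈ falseClaims Γ w F K N j)
      (fun j hj hij ih => fold hχ (by omega) (by simp)
        (.inr ⟨a j (Finset.mem_Ico.2 ⟨hij, hj⟩), ih⟩))
      hik (fold hχ hN (by simp) (.inl b))
  | box φ h1 =>
    replace h1 := fun i => @h1 (fun θ h => hχ θ (by simp [closure, h])) (by simp at hn; omega) i
    simp only [Sat, not_forall] at hs
    obtain ⟨k, hik, hk⟩ := hs
    filter_upwards [eventually_gt_atTop k, h1 k hk] with N hN a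
    exact Nat.decreasingInduction' (P := fun j => box φ ∈ falseClaims Γ w F K N j)
      (fun j hj hij ih => fold hχ (by omega) (by simp) (.inr ih))
      hik (fold hχ hN (by simp) (.inl a))
  | diaVar x φ h1 =>
    replace h1 := fun i => @h1 (fun θ h => hχ θ (by simp [closure, h])) (by simp at hn; omega) i
    simp only [Sat, not_exists, not_and] at hs
    have hev : ∀ᶠ N in atTop, ∀ j ∈ Finset.Icc i (K + i), φ ∈ falseClaims Γ w F K N j :=
      (eventually_all_finset _).2 fun j hj =>
        h1 j (hs j (Finset.mem_Icc.1 hj).1 (Finset.mem_Icc.1 hj).2)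
    filter_upwards [eventually_gt_atTop i, hev] with N hN a
    refine mem_falseClaims.2 ⟨hχ _ (mem_closure_self _), hN, trivial, fun y ψ he j hj hj' => ?_⟩
    cases he
    exact a j (Finset.mem_Icc.2 ⟨hj, hj'⟩)
  | diaConst c φ h1 =>
    replace h1 := fun i => @h1 (fun θ h => hχ θ (by simp [closure, h])) (by simp at hn; omega) i
    induction c generalizing i with
    | zero =>
      rw [sat_diaConst_zero] at hs
      filter_upwards [eventually_gt_atTop i, h1 i hs] with N hN a using fold hχ hN (by simp) a
    | succ c ih =>
      rw [sat_diaConst_succ, not_or] at hs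
      have := ih (fun θ h => hχ θ (closure_diaConst_subset c φ h)) (by simp at hn ⊢; omega) hs.2
      filter_upwards [eventually_gt_atTop i, h1 i hs.1, this] with N hN a b
      exact fold hχ hN (by simp) ⟨a, b⟩
  | boxConst c φ h1 =>
    replace h1 := fun i => @h1 (fun θ h => hχ θ (by simp [closure, h])) (by simp at hn; omega) i
    induction c generalizing i with
    | zero =>
      rw [sat_boxConst_zero] at hs
      filter_upwards [eventually_gt_atTop i, h1 i hs] with N hN a using fold hχ hN (by simp) a
    | succ c ih =>
      rw [sat_boxConst_succ, not_and_or] at hs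
      rcases hs with hs | hs
      · filter_upwards [eventually_gt_atTop i, h1 i hs] with N hN a
        exact fold hχ hN (by simp) (.inl a)
      · have := ih (fun θ h => hχ θ (closure_boxConst_subset c φ h)) (by simp at hn ⊢; omega) hs
        filter_upwards [eventually_gt_atTop i, this] with N hN a
        exact fold hχ hN (by simp) (.inr a)
  -- The case of `until`, which is a reserved word and cannot name an alternative.
  | _ φ ψ h1 h2 =>
    replace h1 := fun i => @h1 (fun θ h => hχ θ (by simp [closure, h])) (by simp at hn; omega) i
    replace h2 := fun i => @h2 (fun θ h => hχ θ (by simp [closure, h])) (by simp at hn; omega) i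
    by_cases hall : ∀ j, i ≤ j → ¬ Sat w (fun _ : Var => K) j ψ
    · obtain ⟨k, hik, hk⟩ := hF ψ (fun θ h => hχ θ (by simp [closure, h])) (by simp at hn; omega)
        i hall
      have hev : ∀ᶠ N in atTop, ∀ j ∈ Finset.Icc i k, ψ ∈ falseClaims Γ w F K N j :=
        (eventually_all_finset _).2 fun j hj => h2 j (hall j (Finset.mem_Icc.1 hj).1)
      filter_upwards [eventually_gt_atTop k, hev] with N hN a
      exact Nat.decreasingInduction' (P := fun j => Formula.until φ ψ ∈ falseClaims Γ w F K N j)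
        (fun j hj hij ih => fold hχ (by omega) (by simp)
          (.inr ⟨a j (Finset.mem_Icc.2 ⟨hij, hj.le⟩), .inr ih⟩)) hik
        (fold hχ hN (by simp) (.inl hk))
    · -- `φ` fails before the first position at which `ψ` holds.
      have hex : ∃ k, i ≤ k ∧ Sat w (fun _ : Var => K) k ψ := by
        push Not at hall
        exact hall
      classical
      obtain ⟨hik, hk⟩ := Nat.find_spec hex
      have hmin : ∀ j, i ≤ j → j < Nat.find hex → ¬ Sat w (fun _ : Var => K) j ψ :=
        fun j hj hlt h => Nat.find_min hex hlt ⟨hj, h⟩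
      generalize Nat.find hex = k at hik hk hmin
      have hex' : ∃ l, i ≤ l ∧ l < k ∧ ¬ Sat w (fun _ : Var => K) l φ := by
        by_contra! hno
        exact hs ⟨k, hik, hk, hno⟩
      obtain ⟨l, hil, hlk, hl⟩ := hex'
      have hev : ∀ᶠ N in atTop, ∀ j ∈ Finset.Icc i l, ψ ∈ falseClaims Γ w F K N j :=
        (eventually_all_finset _).2 fun j hj =>
          h2 j (hmin j (Finset.mem_Icc.1 hj).1 ((Finset.mem_Icc.1 hj).2.trans_lt hlk))
      filter_upwards [eventually_gt_atTop l, hev, h1 l hl] with N hN a b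
      exact Nat.decreasingInduction' (P := fun j => Formula.until φ ψ ∈ falseClaims Γ w F K N j)
        (fun j hj hij ih => fold hχ (by omega) (by simp)
          (.inr ⟨a j (Finset.mem_Icc.2 ⟨hij, hj.le⟩), .inr ih⟩)) hil
        (fold hχ hN (by simp) (.inr ⟨a l (Finset.mem_Icc.2 ⟨hil, le_rfl⟩), .inl b⟩))

end Formula
end PLTL

/-! ### Loops in runs -/

namespace PLTL

/-- A sequence of states `s`, all of whose steps are allowed by `E`, together with sets of claims
`T i ⊆ Γ` that obey the local rule `R` and are empty from position `N` on. -/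
structure IsRun {S α : Type*} (E : S → S → Prop) (R : S → Set α → Set α → α → Prop)
    (Γ : Finset α) (N : ℕ) (s : ℕ → S) (T : ℕ → Set α) : Prop where
  step : ∀ i, E (s i) (s (i + 1))
  subset : ∀ i, ∀ χ ∈ T i, χ ∈ Γ
  support : ∀ i, N ≤ i → T i = ∅
  rule : ∀ i, ∀ χ ∈ T i, R (s i) (T i) (T (i + 1)) χ

/-- `i ↦ if i < a then i else i + (b - a)` skips the positions `a, …, b - 1`. For a function that
agrees at `a` and `b` this respects successors. -/
theorem cut_succ {β : Type*} (g : ℕ → β) {a b : ℕ} (hab : a < b) (hg : g a = g b) (i : ℕ) :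
    g (if i + 1 < a then i + 1 else i + 1 + (b - a)) =
      g ((if i < a then i else i + (b - a)) + 1) := by
  rcases lt_trichotomy (i + 1) a with h1 | h1 | h1
  · rw [if_pos h1, if_pos (by omega)]
  · rw [if_neg (by omega), if_pos (by omega), h1, hg]
    congr 1
    omega
  · rw [if_neg (by omega), if_neg (by omega)]
    congr 1
    omega

theorem cut_zero {β : Type*} (g : ℕ → β) {a b : ℕ} (hg : g a = g b) :
    g (if 0 < a then 0 else 0 + (b - a)) = g 0 := by
  rcases Nat.eq_zero_or_pos a with rfl | ha
  · simpa using hg.symm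
  · rw [if_pos ha]

/-- `i ↦ if i < b then i else i - (b - a)` runs twice through the positions `a, …, b - 1`. For a
function that agrees at `a` and `b` this respects successors. -/
theorem insert_succ {β : Type*} (g : ℕ → β) {a b : ℕ} (hab : a < b) (hg : g a = g b) (i : ℕ) :
    g (if i + 1 < b then i + 1 else i + 1 - (b - a)) =
      g ((if i < b then i else i - (b - a)) + 1) := by
  rcases lt_trichotomy (i + 1) b with h1 | h1 | h1
  · rw [if_pos h1, if_pos (by omega)]
  · rw [if_neg (by omega), if_pos (by omega), h1, ← hg]
    congr 1
    omega
  · rw [if_neg (by omega), if_neg (by omega)]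
    congr 1
    omega

section Loops

variable {S α : Type*} {E : S → S → Prop} {R : S → Set α → Set α → α → Prop} {Γ : Finset α}
  {N : ℕ} {s : ℕ → S} {T : ℕ → Set α}

/-- Among sufficiently many consecutive positions, two carry the same state and the same claims, and
agree in a further value `c` that ranges over `k` numbers. -/
theorem exists_loop [Fintype S] (s : ℕ → S) (hT : ∀ i, ∀ χ ∈ T i, χ ∈ Γ) {i k K : ℕ} (c : ℕ → ℕ)
    (hc : ∀ j, i ≤ j → c j < k) (hK : Fintype.card S * k * 2 ^ Γ.card ≤ K) :
    ∃ a b, i ≤ a ∧ a < b ∧ b ≤ K + i ∧ s a = s b ∧ T a = T b ∧ c a = c b := by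
  classical
  set f : ℕ → S × ℕ × Finset α := fun j => (s j, c j, Γ.filter (· ∈ T j)) with hf
  have hmaps : ∀ j ∈ Finset.Icc i (K + i),
      f j ∈ Finset.univ ×ˢ Finset.range k ×ˢ Γ.powerset := by
    intro j hj
    simp only [hf, Finset.mem_product, Finset.mem_univ, true_and, Finset.mem_range,
      Finset.mem_powerset]
    exact ⟨hc j (Finset.mem_Icc.1 hj).1, Finset.filter_subset _ _⟩
  have hcard : (Finset.univ ×ˢ Finset.range k ×ˢ Γ.powerset : Finset (S × ℕ × Finset α)).card <
      (Finset.Icc i (K + i)).card := by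
    rw [Finset.card_product, Finset.card_product, Finset.card_powerset, Finset.card_range,
      Nat.card_Icc, Finset.card_univ, ← mul_assoc]
    omega
  obtain ⟨x, hx, y, hy, hne, hxy⟩ := Finset.exists_ne_map_eq_of_card_lt_of_maps_to hcard hmaps
  have hTeq : T x = T y := by
    have h := (Prod.ext_iff.1 (Prod.ext_iff.1 hxy).2).2
    ext χ
    have h' := Finset.ext_iff.1 h χ
    simp only [hf, Finset.mem_filter] at h'
    exact ⟨fun hχ => (h'.1 ⟨hT _ _ hχ, hχ⟩).2, fun hχ => (h'.2 ⟨hT _ _ hχ, hχ⟩).2⟩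
  have hseq : s x = s y := (Prod.ext_iff.1 hxy).1
  have hceq : c x = c y := (Prod.ext_iff.1 (Prod.ext_iff.1 hxy).2).1
  rw [Finset.mem_Icc] at hx hy
  rcases lt_or_gt_of_ne hne with h | h
  · exact ⟨x, y, hx.1, h, hy.2, hseq, hTeq, hceq⟩
  · exact ⟨y, x, hy.1, h, hx.2, hseq.symm, hTeq.symm, hceq.symm⟩

/-- Removing the loop between the positions `a < b`. -/
theorem IsRun.cut (h : IsRun E R Γ N s T) {a b : ℕ} (hab : a < b) (hb : b ≤ N) (hs : s a = s b)
    (hT : T a = T b) :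
    IsRun E R Γ (N - (b - a)) (fun i => s (if i < a then i else i + (b - a)))
      (fun i => T (if i < a then i else i + (b - a))) := by
  refine ⟨fun i => ?_, fun i => h.subset _, fun i hi => ?_, fun i χ hχ => ?_⟩
  · rw [cut_succ s hab hs]
    exact h.step _
  · rw [if_neg (by omega)]
    exact h.support _ (by omega)
  · rw [cut_succ T hab hT]
    exact h.rule _ χ hχ

/-- Inserting a second copy of the loop between the positions `a < b`. -/
theorem IsRun.insert (h : IsRun E R Γ N s T) {a b : ℕ} (hab : a < b) (hs : s a = s b)
    (hT : T a = T b) :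
    IsRun E R Γ (N + b) (fun i => s (if i < b then i else i - (b - a)))
      (fun i => T (if i < b then i else i - (b - a))) := by
  refine ⟨fun i => ?_, fun i => h.subset _, fun i hi => ?_, fun i χ hχ => ?_⟩
  · rw [insert_succ s hab hs]
    exact h.step _
  · rw [if_neg (by omega)]
    exact h.support _ (by omega)
  · rw [insert_succ T hab hT]
    exact h.rule _ χ hχ

/-- Cutting loops as long as there are any leaves a run that makes its claims at no more positions
than there are pairs of a state and a set of claims. -/
theorem IsRun.exists_short [Fintype S] (h : IsRun E R Γ N s T) :
    ∃ N' s' T', IsRun E R Γ N' s' T' ∧ N' ≤ Fintype.card S * 2 ^ Γ.card ∧ s' 0 = s 0 ∧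
      T' 0 = T 0 := by
  induction N using Nat.strong_induction_on generalizing s T with
  | _ N ih =>
    by_cases hN : N ≤ Fintype.card S * 2 ^ Γ.card
    · exact ⟨N, s, T, h, hN, rfl, rfl⟩
    · obtain ⟨a, b, -, hab, hb, hs, hT, -⟩ := exists_loop s h.subset (i := 0) (k := 1)
        (fun _ => 0) (fun _ _ => one_pos) (K := Fintype.card S * 2 ^ Γ.card) (by simp)
      obtain ⟨N', s', T', h1, h2, h3, h4⟩ :=
        ih (N - (b - a)) (by omega) (h.cut hab (by omega) hs hT)
      exact ⟨N', s', T', h1, h2, h3.trans (cut_zero s hs), h4.trans (cut_zero T hT)⟩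

end Loops

namespace Formula

variable {S AP Var : Type*} {E : S → S → Prop}
  {R : S → Set (Formula AP Var) → Set (Formula AP Var) → Formula AP Var → Prop}
  {Γ : Finset (Formula AP Var)} {N K L : ℕ} {s : ℕ → S} {T : ℕ → Set (Formula AP Var)}

/-- A second copy of a loop does not shorten any window, provided that what is claimed by some
`◇_{≤ x} φ` on the loop is claimed on the whole loop. -/
theorem HasWindow.insert {a b p : ℕ} (hab : a < b)
    (hloop : ∀ x φ c, a ≤ c → c ≤ b → diaVar x φ ∈ T c → ∀ j, a ≤ j → j ≤ b → φ ∈ T j)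
    (h : HasWindow L T (if p < b then p else p - (b - a))) :
    HasWindow L (fun i => T (if i < b then i else i - (b - a))) p := by
  intro x φ hx q hpq hq
  by_cases hp : p < b
  · simp only [if_pos hp] at h hx
    by_cases hqb : q < b
    · simp only [if_pos hqb]
      exact h x φ hx q hpq hq
    · simp only [if_neg hqb]
      by_cases hpq' : p ≤ q - (b - a)
      · exact h x φ hx _ hpq' (by omega)
      · exact hloop x φ p (by omega) hp.le hx _ (by omega) (by omega)
  · simp only [if_neg hp, if_neg (show ¬ q < b by omega)] at h hx ⊢
    exact h x φ hx _ (by omega) (by omega)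

/-- If all windows have length `K`, then the `K + 1` positions from a claim of some `◇_{≤ x} φ` on
contain a loop such that, for every `◇_{≤ x} φ` claimed on the loop, `φ` is claimed on all of it. -/
theorem exists_windowed_loop [Fintype S] (s : ℕ → S) (hΓ : ∀ i, ∀ χ ∈ T i, χ ∈ Γ)
    (hK : Fintype.card S * Γ.card * 2 ^ Γ.card ≤ K) (hw : ∀ i, HasWindow K T i) {i : ℕ}
    (hi : ∃ x φ, diaVar x φ ∈ T i) :
    ∃ a b, i ≤ a ∧ a < b ∧ b ≤ K + i ∧ s a = s b ∧ T a = T b ∧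
      ∀ x φ c, a ≤ c → c ≤ b → diaVar x φ ∈ T c → ∀ j, a ≤ j → j ≤ b → φ ∈ T j := by
  classical
  -- The claims `◇_{≤ x} φ` made between `i` and `j`. These sets increase with `j`, so that sets of
  -- the same size are equal.
  set D : ℕ → Finset (Formula AP Var) := fun j =>
    Γ.filter fun δ => (∃ x φ, δ = diaVar x φ) ∧ ∃ c, i ≤ c ∧ c ≤ j ∧ δ ∈ T c with hD
  have hmono : ∀ {j k}, j ≤ k → D j ⊆ D k := by
    intro j k hjk δ hδ
    simp only [hD, Finset.mem_filter] at hδ ⊢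
    obtain ⟨h1, h2, c, h3, h4, h5⟩ := hδ
    exact ⟨h1, h2, c, h3, by omega, h5⟩
  have hpos : ∀ j, i ≤ j → 0 < (D j).card := by
    intro j hj
    obtain ⟨x, φ, hx⟩ := hi
    exact Finset.card_pos.2 ⟨diaVar x φ, Finset.mem_filter.2
      ⟨hΓ _ _ hx, ⟨x, φ, rfl⟩, i, le_rfl, hj, hx⟩⟩
  -- The sizes range over `1, …, |Γ|`, hence the shift by one.
  obtain ⟨a, b, hia, hab, hb, hs, hT, hc⟩ := exists_loop s hΓ (k := Γ.card)
    (fun j => (D j).card - 1) (fun j hj => by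
      have h1 := hpos j hj
      have h2 : (D j).card ≤ Γ.card := Finset.card_filter_le _ _
      omega) hK
  refine ⟨a, b, hia, hab, hb, hs, hT, fun x φ c hac hcb hx j haj hjb => ?_⟩
  have h1 := hpos a hia
  have h2 := hpos b (by omega)
  -- A formula claimed on the loop has been claimed before the loop, with a window that covers it.
  have hDab : D a = D b := Finset.eq_of_subset_of_card_le (hmono hab.le) (by omega)
  have hmem : diaVar x φ ∈ D b :=
    Finset.mem_filter.2 ⟨hΓ _ _ hx, ⟨x, φ, rfl⟩, c, by omega, hcb, hx⟩
  rw [← hDab] at hmem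
  obtain ⟨-, -, c', h3, h4, h5⟩ := Finset.mem_filter.1 hmem
  exact hw c' x φ h5 j (by omega) (by omega)

/-- If the windows after position `i` have length `L`, then those at `i` can be lengthened from
`l ≥ K` to `L = l + d`. Every further copy of a loop adds at least one position to them. -/
theorem exists_isRun_hasWindow_ge [Fintype S]
    (hK : Fintype.card S * Γ.card * 2 ^ Γ.card ≤ K) {i l d : ℕ} (hKl : K ≤ l) (hl : l + d = L)
    (h : IsRun E R Γ N s T) (hw : ∀ j, HasWindow K T j) (hi : HasWindow l T i)
    (hL : ∀ j, i < j → HasWindow L T j) :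
    ∃ N' s' T', IsRun E R Γ N' s' T' ∧ s' 0 = s 0 ∧ T' 0 = T 0 ∧ (∀ j, HasWindow K T' j) ∧
      ∀ j, i ≤ j → HasWindow L T' j := by
  induction d generalizing l N s T with
  | zero =>
    refine ⟨N, s, T, h, rfl, rfl, hw, fun j hj => ?_⟩
    rcases Nat.lt_or_eq_of_le hj with hj | rfl
    · exact hL j hj
    · rwa [← hl, Nat.add_zero]
  | succ d ih =>
    by_cases hex : ∃ x φ, diaVar x φ ∈ T i
    · obtain ⟨a, b, hia, hab, hb, hs, hT, hloop⟩ := exists_windowed_loop s h.subset hK hw hex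
      rcases Nat.lt_or_eq_of_le hia with hia | rfl
      · have h0 : (if 0 < b then 0 else 0 - (b - a)) = 0 := by simp
        have hi' : HasWindow (l + 1) (fun j => T (if j < b then j else j - (b - a))) i := by
          intro x φ hx j hj hj'
          simp only [if_pos (show i < b by omega)] at hx
          by_cases hjb : j < b
          · simp only [if_pos hjb]
            exact hi x φ hx j hj (by omega)
          · simp only [if_neg hjb]
            exact hi x φ hx _ (by omega) (by omega)
        obtain ⟨N', s', T', h1, h2, h3, h4⟩ := ih (l := l + 1) (by omega) (by omega)
          (h.insert hab hs hT) (fun j => .insert hab hloop (hw _)) hi'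
          (fun j hj => .insert hab hloop (hL _ (by split_ifs <;> omega)))
        exact ⟨N', s', T', h1, h2.trans (congrArg s h0), h3.trans (congrArg T h0), h4⟩
      · -- The claims of position `i` recur at `b`, whose windows are long enough for both.
        refine ⟨N, s, T, h, rfl, rfl, hw, fun j hj => ?_⟩
        rcases Nat.lt_or_eq_of_le hj with hj | rfl
        · exact hL j hj
        · intro x φ hx j hj hj'
          rcases Nat.le_total j b with hjb | hjb
          · exact hloop x φ i le_rfl hab.le hx j hj hjb
          · exact hL b hab x φ (hT ▸ hx) j hjb (by omega)
    · refine ⟨N, s, T, h, rfl, rfl, hw, fun j hj => ?_⟩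
      rcases Nat.lt_or_eq_of_le hj with hj | rfl
      · exact hL j hj
      · exact fun x φ hx => absurd ⟨x, φ, hx⟩ hex

/-- Windows of length `K ≥ |S| · |Γ| · 2 ^ |Γ|` can be lengthened arbitrarily. -/
theorem exists_isRun_hasWindow [Fintype S] (hK : Fintype.card S * Γ.card * 2 ^ Γ.card ≤ K)
    (hKL : K ≤ L) (h : IsRun E R Γ N s T) (hw : ∀ j, HasWindow K T j) :
    ∃ N' s' T', IsRun E R Γ N' s' T' ∧ s' 0 = s 0 ∧ T' 0 = T 0 ∧ ∀ j, HasWindow L T' j := by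
  have key : ∀ i N s T, IsRun E R Γ N s T → (∀ j, HasWindow K T j) →
      (∀ j, i ≤ j → HasWindow L T j) →
      ∃ N' s' T', IsRun E R Γ N' s' T' ∧ s' 0 = s 0 ∧ T' 0 = T 0 ∧ ∀ j, HasWindow L T' j := by
    intro i
    induction i with
    | zero => exact fun N s T h _ hL => ⟨N, s, T, h, rfl, rfl, fun j => hL j (Nat.zero_le _)⟩
    | succ i ih =>
      intro N s T h hw hL
      obtain ⟨N₁, s₁, T₁, h1, h2, h3, h4, h5⟩ := exists_isRun_hasWindow_ge hK le_rfl
        (Nat.add_sub_cancel' hKL) h hw (hw i) fun j hj => hL j hj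
      obtain ⟨N₂, s₂, T₂, h6, h7, h8, h9⟩ := ih N₁ s₁ T₁ h1 h4 h5
      exact ⟨N₂, s₂, T₂, h6, h7.trans h2, h8.trans h3, h9⟩
  refine key N N s T h hw fun j hj x φ hx => ?_
  rw [h.support j hj] at hx
  exact hx.elim

end Formula
end PLTL

/-! ### From probabilities to runs and back -/

namespace PLTL
namespace MarkovChain

open Formula Filter

variable {S AP Var : Type*} [Fintype S] [MeasurableSpace S] [DiscreteMeasurableSpace S]
  {Γ : Finset (Formula AP Var)} {K L : ℕ} {χ : Formula AP Var}

/-- The formulas of `Γ` that are almost surely true at all positions of the paths from `s`, when all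
variables have the value `K`. -/
def alwaysTrue (M : MarkovChain S AP) (Γ : Finset (Formula AP Var)) (K : ℕ) (s : S) :
    Set (Formula AP Var) :=
  {ψ | ψ ∈ Γ ∧ M.Forces s (M.models (fun _ => K) ψ)}

/-- The formulas of `Γ` that are almost surely false at all positions of the paths from `s`, when
all variables have the value `K`. -/
def alwaysFalse (M : MarkovChain S AP) (Γ : Finset (Formula AP Var)) (K : ℕ) (s : S) :
    Set (Formula AP Var) :=
  {ψ | ψ ∈ Γ ∧ M.Forces s (M.models (fun _ => K) ψ)ᶜ}

/-- A prefix along transitions of positive probability has positive probability, hence so has every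
set that contains almost all of its continuations. -/
theorem pathLaw_ne_zero_of_prefix (M : MarkovChain S AP) {s : ℕ → S}
    (hs : ∀ i, 0 < M.P (s i) (s (i + 1))) (N : ℕ) {B : Set (ℕ → S)}
    (h : ∀ᵐ π ∂M.pathLaw (s 0), (∀ i ≤ N, π i = s i) → π ∈ B) : M.pathLaw (s 0) B ≠ 0 := by
  intro hB
  have h1 : M.pathLaw (s 0) {π | ∀ i ≤ N, π i = s i} = 0 := by
    have hB' : ∀ᵐ π ∂M.pathLaw (s 0), π ∉ B := measure_eq_zero_iff_ae_notMem.1 hB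
    refine measure_eq_zero_iff_ae_notMem.2 ?_
    filter_upwards [h, hB'] with π h2 h3 h4 using h3 (h2 h4)
  rw [pathLaw_cylinder, Finset.prod_eq_zero_iff] at h1
  obtain ⟨i, -, hi⟩ := h1
  exact (ENNReal.ofReal_pos.2 (hs i)).ne' hi

theorem Forces.shift_mem {M : MarkovChain S AP} {E : Set (ℕ → S)} {π : ℕ → S}
    (hπ : ∀ i, 0 < M.P (π i) (π (i + 1))) (hE : ∀ j, M.pathLaw (π j) Eᶜ = 0 → shift j π ∈ E)
    {i j : ℕ} (h : M.Forces (π i) E) (hij : i ≤ j) : shift j π ∈ E :=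
  hE j (h _ (M.reachable_of_le hπ hij))

/-- The claims of a run of length at most `K` are correct on almost all paths that start with the
states of the run. -/
theorem pathLaw_models_ne_zero_of_isRun (M : MarkovChain S AP) {N : ℕ} {s : ℕ → S}
    {T : ℕ → Set (Formula AP Var)}
    (h : IsRun (fun s t => 0 < M.P s t) (fun s => TruthRule (M.label s) (M.alwaysTrue Γ K s)) Γ
      N s T) (hN : N ≤ K) (hχ : χ ∈ T 0) :
    M.pathLaw (s 0) (M.models (fun _ => K) χ) ≠ 0 := by
  refine M.pathLaw_ne_zero_of_prefix h.step N ?_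
  have hev : ∀ᵐ π ∂M.pathLaw (s 0), ∀ ψ ∈ Γ, ∀ j,
      M.pathLaw (π j) (M.models (fun _ => K) ψ)ᶜ = 0 → shift j π ∈ M.models (fun _ => K) ψ :=
    (eventually_all_finset _).2 fun ψ _ =>
      ae_all_iff.2 fun j => M.ae_shift_mem _ (M.measurableSet_models _ ψ) j
  filter_upwards [M.ae_pathLaw_step (s 0), hev] with π hstep hπ hpre
  have hlt : ∀ {i θ}, θ ∈ T i → i < N := by
    intro i θ hθ
    by_contra hi
    rw [h.support i (not_lt.1 hi)] at hθ
    exact hθ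
  refine sat_of_truthRule (F := fun i => M.alwaysTrue Γ K (s i)) h.support (fun i θ hθ => ?_)
    (fun i θ hθ hi j hij => ?_) hN hχ
  · rw [trace, hpre i (hlt hθ).le]
    exact h.rule i θ hθ
  · rw [← hpre i hi.le] at hθ
    exact (M.shift_mem_models _ θ j π).1 (hθ.2.shift_mem hstep (hπ θ hθ.1) hij)

/-- The claims of falsity of a run with windows of length `K` are correct on almost all paths that
start with the states of the run. -/
theorem pathLaw_compl_models_ne_zero_of_isRun (M : MarkovChain S AP) {N : ℕ} {s : ℕ → S}
    {T : ℕ → Set (Formula AP Var)}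
    (h : IsRun (fun s t => 0 < M.P s t) (fun s => FalsityRule (M.label s) (M.alwaysFalse Γ K s)) Γ
      N s T) (hw : ∀ i, HasWindow K T i) (hχ : χ ∈ T 0) :
    M.pathLaw (s 0) (M.models (fun _ => K) χ)ᶜ ≠ 0 := by
  refine M.pathLaw_ne_zero_of_prefix h.step N ?_
  have hev : ∀ᵐ π ∂M.pathLaw (s 0), ∀ ψ ∈ Γ, ∀ j,
      M.pathLaw (π j) (M.models (fun _ => K) ψ)ᶜᶜ = 0 → shift j π ∈ (M.models (fun _ => K) ψ)ᶜ :=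
    (eventually_all_finset _).2 fun ψ _ =>
      ae_all_iff.2 fun j => M.ae_shift_mem _ (M.measurableSet_models _ ψ).compl j
  filter_upwards [M.ae_pathLaw_step (s 0), hev] with π hstep hπ hpre
  have hlt : ∀ {i θ}, θ ∈ T i → i < N := by
    intro i θ hθ
    by_contra hi
    rw [h.support i (not_lt.1 hi)] at hθ
    exact hθ
  refine not_sat_of_falsityRule (F := fun i => M.alwaysFalse Γ K (s i)) h.support
    (fun i θ hθ => ?_) (fun i θ hθ hi j hij => ?_) hw hχ
  · rw [trace, hpre i (hlt hθ).le]
    exact h.rule i θ hθ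
  · rw [← hpre i hi.le] at hθ
    exact fun hs => hθ.2.shift_mem hstep (hπ θ hθ.1) hij ((M.shift_mem_models _ θ j π).2 hs)

/-- If `χ` has positive probability when the variables have the value `L`, then this is witnessed by
a run of claims of truth. Claims can be dropped where they are almost surely true forever; the
hypothesis `hF` makes this possible for the value `K` instead of `L`. -/
theorem exists_isRun_truthRule (M : MarkovChain S AP) (hχ : ∀ θ ∈ χ.closure, θ ∈ Γ)
    (hF : ∀ ψ : Formula AP Var, (∀ θ ∈ ψ.closure, θ ∈ Γ) → sizeOf ψ < sizeOf χ → ∀ t,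
      M.pathLaw t (M.models (fun _ => L) ψ)ᶜ = 0 → M.pathLaw t (M.models (fun _ => K) ψ)ᶜ = 0)
    {t : S} (h : M.pathLaw t (M.models (fun _ => L) χ) ≠ 0) :
    ∃ N s T, IsRun (fun s t => 0 < M.P s t)
      (fun s => TruthRule (M.label s) (M.alwaysTrue Γ K s)) Γ N s T ∧ s 0 = t ∧ χ ∈ T 0 := by
  have hev : ∀ᵐ π ∂M.pathLaw t, ∀ ψ ∈ Γ, ∀ i,
      (∀ j, i ≤ j → shift j π ∈ M.models (fun _ => L) ψ) →
        ∃ n, i ≤ n ∧ M.Forces (π n) (M.models (fun _ => L) ψ) :=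
    (eventually_all_finset _).2 fun ψ _ =>
      ae_all_iff.2 fun i => M.ae_exists_forces _ (M.measurableSet_models _ ψ) i
  obtain ⟨π, hπ, hstep, h0, hforce⟩ := (frequently_ae_mem_iff.2 h).and_eventually
    ((M.ae_pathLaw_step t).and ((M.ae_pathLaw_zero t).and hev)) |>.exists
  obtain ⟨N, hN⟩ := (eventually_mem_trueClaims (w := M.trace π) (Γ := ↑Γ)
    (F := fun i => M.alwaysTrue Γ K (π i)) (v := fun _ => L)
    (fun ψ hψ hlt i hi => by
      obtain ⟨n, hn, hfn⟩ := hforce ψ (hψ ψ ψ.mem_closure_self) i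
        fun j hj => (M.shift_mem_models _ ψ j π).2 (hi j hj)
      exact ⟨n, hn, hψ ψ ψ.mem_closure_self, fun r hr => hF ψ hψ hlt r (hfn r hr)⟩)
    hχ le_rfl hπ).exists
  exact ⟨N, π, _, ⟨hstep, fun i θ hθ => (mem_trueClaims.1 hθ).1,
    fun i hi => Set.eq_empty_of_forall_notMem fun θ hθ =>
      absurd (mem_trueClaims.1 hθ).2.1 (not_lt.2 hi),
    fun i θ hθ => (mem_trueClaims.1 hθ).2.2⟩, h0, hN⟩

/-- If `χ` fails with positive probability when the variables have the value `K`, then this is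
witnessed by a run of claims of falsity with windows of length `K`. -/
theorem exists_isRun_falsityRule (M : MarkovChain S AP) (hχ : ∀ θ ∈ χ.closure, θ ∈ Γ)
    (hF : ∀ ψ : Formula AP Var, (∀ θ ∈ ψ.closure, θ ∈ Γ) → sizeOf ψ < sizeOf χ → ∀ t,
      M.pathLaw t (M.models (fun _ => K) ψ) = 0 → M.pathLaw t (M.models (fun _ => L) ψ) = 0)
    {t : S} (h : M.pathLaw t (M.models (fun _ => K) χ)ᶜ ≠ 0) :
    ∃ N s T, IsRun (fun s t => 0 < M.P s t)
      (fun s => FalsityRule (M.label s) (M.alwaysFalse Γ L s)) Γ N s T ∧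
      (∀ i, HasWindow K T i) ∧ s 0 = t ∧ χ ∈ T 0 := by
  have hev : ∀ᵐ π ∂M.pathLaw t, ∀ ψ ∈ Γ, ∀ i,
      (∀ j, i ≤ j → shift j π ∈ (M.models (fun _ => K) ψ)ᶜ) →
        ∃ n, i ≤ n ∧ M.Forces (π n) (M.models (fun _ => K) ψ)ᶜ :=
    (eventually_all_finset _).2 fun ψ _ =>
      ae_all_iff.2 fun i => M.ae_exists_forces _ (M.measurableSet_models _ ψ).compl i
  obtain ⟨π, hπ, hstep, h0, hforce⟩ := (frequently_ae_mem_iff.2 h).and_eventually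
    ((M.ae_pathLaw_step t).and ((M.ae_pathLaw_zero t).and hev)) |>.exists
  obtain ⟨N, hN⟩ := (eventually_mem_falseClaims (w := M.trace π) (Γ := ↑Γ)
    (F := fun i => M.alwaysFalse Γ L (π i)) (K := K)
    (fun ψ hψ hlt i hi => by
      obtain ⟨n, hn, hfn⟩ := hforce ψ (hψ ψ ψ.mem_closure_self) i
        fun j hj hs => hi j hj ((M.shift_mem_models _ ψ j π).1 hs)
      refine ⟨n, hn, hψ ψ ψ.mem_closure_self, fun r hr => ?_⟩
      have := hfn r hr
      rw [compl_compl] at this ⊢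
      exact hF ψ hψ hlt r this)
    hχ le_rfl hπ).exists
  exact ⟨N, π, _, ⟨hstep, fun i θ hθ => (mem_falseClaims.1 hθ).1,
    fun i hi => Set.eq_empty_of_forall_notMem fun θ hθ =>
      absurd (mem_falseClaims.1 hθ).2.1 (not_lt.2 hi),
    fun i θ hθ => (mem_falseClaims.1 hθ).2.2.1⟩,
    fun i x φ hx => (mem_falseClaims.1 hx).2.2.2 x φ rfl, h0, hN⟩

/-- Lowering the value of the variables from `L` to `K ≥ |S| · |Γ| · 2 ^ |Γ|` preserves truth with
positive probability, and raising it from `K` to `L` preserves falsity with positive probability.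
The two statements are proved together, as each uses the other for smaller formulas. -/
theorem pathLaw_models_ne_zero_of_le (M : MarkovChain S AP)
    (hK : Fintype.card S * Γ.card * 2 ^ Γ.card ≤ K) (hKL : K ≤ L)
    (hχ : ∀ θ ∈ χ.closure, θ ∈ Γ) :
    (∀ t, M.pathLaw t (M.models (fun _ => L) χ) ≠ 0 →
      M.pathLaw t (M.models (fun _ => K) χ) ≠ 0) ∧
    ∀ t, M.pathLaw t (M.models (fun _ => K) χ)ᶜ ≠ 0 →
      M.pathLaw t (M.models (fun _ => L) χ)ᶜ ≠ 0 := by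
  induction hn : sizeOf χ using Nat.strong_induction_on generalizing χ with
  | _ n ih =>
    subst hn
    constructor
    · intro t ht
      obtain ⟨N, s, T, hrun, rfl, hT⟩ := M.exists_isRun_truthRule hχ
        (fun ψ hψ hlt r hr => not_not.1 fun h => (ih _ hlt hψ rfl).2 r h hr) ht
      obtain ⟨N', s', T', hrun', hN', hs', hT'⟩ := hrun.exists_short
      rw [← hs']
      refine M.pathLaw_models_ne_zero_of_isRun hrun' (hN'.trans (le_trans ?_ hK)) (hT' ▸ hT)
      have hpos : 0 < Γ.card := Finset.card_pos.2 ⟨χ, hχ χ χ.mem_closure_self⟩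
      exact Nat.mul_le_mul_right _ (Nat.le_mul_of_pos_right _ hpos)
    · intro t ht
      obtain ⟨N, s, T, hrun, hw, rfl, hT⟩ := M.exists_isRun_falsityRule hχ
        (fun ψ hψ hlt r hr => not_not.1 fun h => (ih _ hlt hψ rfl).1 r h hr) ht
      obtain ⟨N', s', T', hrun', hs', hT', hw'⟩ := exists_isRun_hasWindow hK hKL hrun hw
      rw [← hs']
      exact M.pathLaw_compl_models_ne_zero_of_isRun hrun' hw' (hT' ▸ hT)

/-- The restriction to `M.paths` in the definition of `prob` concerns a null set only. -/
theorem prob_eq_pathLaw_models (M : MarkovChain S AP) (v : Var → ℕ) (φ : Formula AP Var) :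
    M.prob v φ = M.pathLaw M.init (M.models v φ) := by
  change M.pathLaw M.init {π | π ∈ M.paths ∧ φ.Sat (M.trace π) v 0} = _
  refine measure_congr ?_
  filter_upwards [M.ae_pathLaw_zero M.init, M.ae_pathLaw_step M.init] with π h0 hstep
  exact propext ⟨fun h => h.2, fun h => ⟨⟨h0, hstep⟩, h⟩⟩

theorem exists_forall_diaVar_le (v : Var → ℕ) (Γ : Finset (Formula AP Var)) :
    ∃ B, ∀ x ψ, diaVar x ψ ∈ Γ → v x ≤ B := by
  let f : Formula AP Var → ℕ := fun θ =>
    match θ with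
    | diaVar x _ => v x
    | _ => 0
  exact ⟨Γ.sup f, fun x ψ h => Finset.le_sup (f := f) h⟩

end MarkovChain
end PLTL

theorem theorem4 {S AP Var : Type*} [Fintype S] [MeasurableSpace S] [DiscreteMeasurableSpace S]
    (M : PLTL.MarkovChain S AP) (φ : PLTL.Formula AP Var) :
    (M.valuationsPos φ).Nonempty ↔
      (fun _ : Var => Fintype.card S * φ.size * 2 ^ φ.size) ∈ M.valuationsPos φ := by
  refine ⟨?_, fun h => ⟨_, h⟩⟩
  rintro ⟨v, hv⟩
  change 0 < M.prob v φ at hv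
  change 0 < M.prob _ φ
  rw [PLTL.MarkovChain.prob_eq_pathLaw_models, pos_iff_ne_zero] at hv ⊢
  obtain ⟨B, hB⟩ := PLTL.MarkovChain.exists_forall_diaVar_le v φ.closure
  refine (M.pathLaw_models_ne_zero_of_le (Γ := φ.closure)
    (L := max B (Fintype.card S * φ.size * 2 ^ φ.size)) le_rfl (le_max_right _ _)
    fun θ h => h).1 _ fun h0 => hv (measure_mono_null (fun π hπ => ?_) h0)
  exact PLTL.Formula.Sat.mono (fun x ψ h => (hB x ψ h).trans (le_max_left _ _)) hπ
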